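/- **Model.** An asynchronous message-passing system consists of $n$ replicas $p_1,\dots,p_n$ and clients $p_{n+1},p_{n+2},\dots$. An implementation of a register consists of a client automaton and a replica automaton; an execution is a sequence of global states separated by atomic events (invocation, receipt of a message, local step, crash, restart), where a step may also send messages and return a response. Clients may crash permanently. A replica may crash and later restart; its volatile state is then lost and it runs an $\textbf{on restart}$ handler on the content of its non-volatile storage, if it has any. At a restart a replica may *roll back*: its non-volatile storage is undetectably reverted to an older version. A replica is *correct* if it is eventually permanently up and never rolls back, and *faulty* otherwise; a correct replica is *benign* if it crashes at least once; a replica is *rollback-faulty* if it rolls back at least once. Messages are not forged, but may be delayed, reordered, duplicated or lost; in a fair execution, if two processes are permanently up from time $t$ on, then every message that one sends to the other from $t$ on is eventually delivered, and a local step that remains enabled at a process that stays up is eventually taken. Let $k\ge 0$, and let $r\le k$ and $b\le n$ be thresholds, each of which may be known or unknown; put $r:=k$ if $r$ is unknown and $b:=n$ if $b$ is unknown. An implementation is a *$k$-tolerant atomic wait-free multi-writer/multi-reader (MWMR) register* if in every execution with at most $k$ faulty replicas, at most $r$ rollback-faulty replicas (if $r$ is known), at most $b$ benign replicas (if $b$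 is known), and any number of client crashes, (i) the reads and writes (any client may issue both, one at a time) are linearizable with respect to a register with initial value $v_0$, and (ii) if the execution is fair, every operation invoked by a client that never crashes returns. **Algorithm $\mathcal A$.** Let $P$ be the condition $2k+r+1\le n<2k+b+1$. Put $q_w=n-k$, and $q_r=n-k$ if $P$ holds, $q_r=k+1$ otherwise. Each replica holds a timestamp $\mathsf{ts}$ (a pair (counter, client identifier), ordered lexicographically), a value, and a flag $\mathsf{stale}$, initially $((0,0),v_0)$ and false. If $P$ holds, the first $2k+r+1$ of the replicas that are equipped with non-volatile storage keep these variables there; all other variables of replicas are volatile and are reset to their initial values at a restart. If $P$ fails, the restart handler sets $\mathsf{stale}$ to true. A replica answers a $\mathtt{READ}$ request with its timestamp (or timestamp and value) unless it is stale; on a request $\mathtt{WRITE}(t,v)$ it adopts $(t,v)$ if $t>\mathsf{ts}$, and acknowledges. A client's $\mathtt{read\_quorum}$ (respectively $\mathtt{write\_quorum}$) sends a $\mathtt{READ}$ (respectively $\mathtt{WRITE}$) request with a fresh identifier to all replicas, again and again, until at least $q_r$ (respectively $q_w$) distinct replicas have answered it. To write $v$, client $p_i$ gets timestamps by $\mathtt{read\_quorum}$,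 takes their largest counter $c$, calls $\mathtt{write\_quorum}$ with $((c+1,i),v)$ and returns $\mathsf{ack}$. To read, it gets timestamp-value pairs by $\mathtt{read\_quorum}$, picks a pair $(t,v)$ with the largest timestamp, calls $\mathtt{write\_quorum}$ with $(t,v)$ and returns $v$. **Theorem.** Let $s$ of the $n$ replicas have non-volatile storage, and suppose that $$n\ge 2k+b+1\qquad\text{or}\qquad\bigl(2k+r+1\le n<2k+b+1\ \text{ and }\ s\ge 2k+r+1\bigr).$$ Then $\mathcal A$ uses non-volatile storage only at replicas that have it, and $\mathcal A$ is a $k$-tolerant atomic wait-free MWMR register. Moreover, the time complexity of $\mathcal A$ for both reads and writes is $4$ message delays. That is, in every execution that satisfies the above bounds on the failures, for every nondecreasing assignment of real times to events: (a) if, at the time $\tau$ of its invocation or of any later event, and for the following $4$ time units, the client and all but at most $k$ replicas are up, every message between processes that are up throughout this period takes at most one time unit, and local computation takes no time, then the operation returns by time $\tau+4$; (b) if every message that is delivered takes at least one time unit, then no operation returns earlier than $4$ time units after its invocation. -/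

import Mathlib

namespace CRR

universe u

/-! ## Crash-restart-rollback message-passing systems -/

/-- Names of the participants: `n` replicas, and clients.  The supply of client names is unlimited;
an execution with finitely many clients is one in which the other names never act. -/
inductive Proc (n : ℕ) : Type
  | rep (i : Fin n)
  | cli (c : ℕ)
  deriving DecidableEq

/-- Operations of a read/write register. -/
inductive Op (V : Type u) : Type u
  | read
  | write (v : V)

/-- Responses of a read/write register. -/
inductive Resp (V : Type u) : Type u
  | value (v : V)
  | ack

/-- What triggers an atomic step of a client automaton: an invocation, the receipt of a message
(links are authenticated, so the sender is known), or the client's own local step. -/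
inductive ClientInput (n : ℕ) (V Msg : Type u) : Type u
  | invoke (op : Op V)
  | recv (src : Proc n) (m : Msg)
  | tick

/-- What triggers an atomic step of a replica automaton. -/
inductive ReplicaInput (n : ℕ) (Msg : Type u) : Type u
  | recv (src : Proc n) (m : Msg)
  | tick

/-- The result of an atomic step of a client: new state, messages sent (with their destinations),
and possibly the response to the operation that is being executed. -/
structure ClientResult (n : ℕ) (V Msg State : Type u) : Type u where
  state : State
  send : List (Proc n × Msg)
  resp : Option (Resp V)

/-- The result of an atomic step of a replica. -/
structure ReplicaResult (n : ℕ) (Msg State : Type u) : Type u where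
  state : State
  send : List (Proc n × Msg)

/-- An implementation of a register storing values of type `V` by `n` replicas: a client automaton
and a replica automaton.

`stable i σ` is the content of the non-volatile storage of replica `i` when its local state is `σ`;
the rest of `σ` is volatile and is lost in a crash.  When replica `i` restarts and finds the content
`γ` in its non-volatile storage, its `on restart` handler is `onRestart i γ`. -/
structure Implementation (n : ℕ) (V : Type u) where
  Msg : Type u
  ClientState : Type u
  ReplicaState : Type u
  Stable : Type u
  clientInit : ℕ → ClientState
  clientStep : ℕ → ClientInput n V Msg → ClientState → ClientResult n V Msg ClientState
  replicaInit : Fin n → ReplicaState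
  replicaStep : Fin n → ReplicaInput n Msg → ReplicaState → ReplicaResult n Msg ReplicaState
  stable : Fin n → ReplicaState → Stable
  onRestart : Fin n → Stable → ReplicaResult n Msg ReplicaState

/-- Replica `i` needs non-volatile storage, i.e. some information survives its crashes. -/
def Implementation.UsesStorage {n : ℕ} {V : Type u} (A : Implementation n V) (i : Fin n) : Prop :=
  ∃ σ σ' : A.ReplicaState, A.stable i σ ≠ A.stable i σ'

/-- Global states.  While a replica is down, `replica i` is the local state in which it crashed (only
its non-volatile part matters from then on).  `busy c` tells that client `c` has invoked an operation
which has not returned yet. -/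
structure Config {n : ℕ} {V : Type u} (A : Implementation n V) where
  client : ℕ → A.ClientState
  replica : Fin n → A.ReplicaState
  up : Proc n → Bool
  busy : ℕ → Bool

def Config.initial {n : ℕ} {V : Type u} (A : Implementation n V) : Config A where
  client := A.clientInit
  replica := A.replicaInit
  up := fun _ => true
  busy := fun _ => false

/-- The events.  `rollback i s` is a restart of replica `i` at which its non-volatile storage has been
reverted to the version that it held at time `s`. -/
inductive Event (n : ℕ) (V Msg : Type u) : Type u
  | idle
  | invoke (c : ℕ) (op : Op V)
  | deliver (src dst : Proc n) (m : Msg)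
  | tick (p : Proc n)
  | crash (p : Proc n)
  | restart (i : Fin n)
  | rollback (i : Fin n) (s : ℕ)

/-- The effect of an event: next global state, messages sent (sender, destination, content), and
possibly the response returned by a client. -/
structure Outcome {n : ℕ} {V : Type u} (A : Implementation n V) where
  next : Config A
  sent : List (Proc n × Proc n × A.Msg)
  resp : Option (ℕ × Resp V)

section Step

variable {n : ℕ} {V : Type u} (A : Implementation n V)

def stepClient (C : Config A) (c : ℕ) (inp : ClientInput n V A.Msg) (pending : Bool) : Outcome A :=
  let o := A.clientStep c inp (C.client c)
  { next := { C with
      client := Function.update C.client c o.state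
      busy := Function.update C.busy c (pending && o.resp.isNone) }
    sent := o.send.map fun x => (Proc.cli c, x)
    resp := o.resp.map fun y => (c, y) }

def stepReplica (C : Config A) (i : Fin n) (inp : ReplicaInput n A.Msg) : Outcome A :=
  let o := A.replicaStep i inp (C.replica i)
  { next := { C with replica := Function.update C.replica i o.state }
    sent := o.send.map fun x => (Proc.rep i, x)
    resp := none }

/-- Replica `i` restarts with content `γ` of its non-volatile storage and executes its handler. -/
def stepRestart (C : Config A) (i : Fin n) (γ : A.Stable) : Outcome A :=
  let o := A.onRestart i γ
  { next := { C with
      replica := Function.update C.replica i o.state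
      up := Function.update C.up (Proc.rep i) true }
    sent := o.send.map fun x => (Proc.rep i, x)
    resp := none }

/-- The effect of an event in the global state `C`; `hist` is the sequence of all global states. -/
def step (hist : ℕ → Config A) (C : Config A) : Event n V A.Msg → Outcome A
  | .idle => ⟨C, [], none⟩
  | .invoke c op => stepClient A C c (.invoke op) true
  | .deliver src (.cli c) m => stepClient A C c (.recv src m) (C.busy c)
  | .deliver src (.rep i) m => stepReplica A C i (.recv src m)
  | .tick (.cli c) => stepClient A C c .tick (C.busy c)
  | .tick (.rep i) => stepReplica A C i .tick
  | .crash p => ⟨{ C with up := Function.update C.up p false }, [], none⟩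
  | .restart i => stepRestart A C i (A.stable i (C.replica i))
  | .rollback i s => stepRestart A C i (A.stable i ((hist s).replica i))

/-- The local step of `p` would change its state, send a message, or return a response. -/
def TickEnabled (C : Config A) : Proc n → Prop
  | .cli c => A.clientStep c .tick (C.client c) ≠ ⟨C.client c, [], none⟩
  | .rep i => A.replicaStep i .tick (C.replica i) ≠ ⟨C.replica i, []⟩

end Step

/-- When event `e` may happen at time `t`, given the global states and the messages sent so far.
Crashed clients do not restart.  Clients invoke operations one at a time.  A message is delivered only
if it was sent; it may be delayed, reordered, duplicated or lost.  A rollback may restore any earlier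
version of the non-volatile storage. -/
def Allowed {n : ℕ} {V : Type u} {A : Implementation n V} (hist : ℕ → Config A)
    (Sent : ℕ → Proc n → Proc n → A.Msg → Prop) (t : ℕ) : Event n V A.Msg → Prop
  | .idle => True
  | .invoke c _ => (hist t).up (.cli c) = true ∧ (hist t).busy c = false
  | .deliver src dst m => (hist t).up dst = true ∧ ∃ s < t, Sent s src dst m
  | .tick p => (hist t).up p = true
  | .crash p => (hist t).up p = true
  | .restart i => (hist t).up (.rep i) = false
  | .rollback i s => (hist t).up (.rep i) = false ∧ s < t

/-- An execution: `cfg t` is the global state at time `t`, and `ev t` the event that leads from it to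
`cfg (t + 1)`.  Finite executions are continued by `idle` events. -/
structure Execution {n : ℕ} {V : Type u} (A : Implementation n V) where
  cfg : ℕ → Config A
  ev : ℕ → Event n V A.Msg
  init : cfg 0 = Config.initial A
  next : ∀ t, cfg (t + 1) = (step A cfg (cfg t) (ev t)).next
  allowed : ∀ t, Allowed cfg
    (fun s src dst m => (src, dst, m) ∈ (step A cfg (cfg s) (ev s)).sent) t (ev t)

namespace Execution

variable {n : ℕ} {V : Type u} {A : Implementation n V} (E : Execution A)

/-- At time `t`, `src` sends the message `m` to `dst`. -/
def Sends (t : ℕ) (src dst : Proc n) (m : A.Msg) : Prop :=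
  (src, dst, m) ∈ (step A E.cfg (E.cfg t) (E.ev t)).sent

/-- At time `t`, client `c` returns the response `y`. -/
def Responds (t : ℕ) (c : ℕ) (y : Resp V) : Prop :=
  (step A E.cfg (E.cfg t) (E.ev t)).resp = some (c, y)

def Up (p : Proc n) (t : ℕ) : Prop := (E.cfg t).up p = true

/-! ### Failures -/

def EventuallyUp (i : Fin n) : Prop := ∃ t, ∀ t' ≥ t, E.Up (.rep i) t'

def RollsBack (i : Fin n) : Prop := ∃ t s, E.ev t = .rollback i s

def Crashes (p : Proc n) : Prop := ∃ t, E.ev t = .crash p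

def CorrectReplica (i : Fin n) : Prop := E.EventuallyUp i ∧ ¬ E.RollsBack i

def FaultyReplica (i : Fin n) : Prop := ¬ E.CorrectReplica i

def BenignReplica (i : Fin n) : Prop := E.CorrectReplica i ∧ E.Crashes (.rep i)

/-- At most `k` replicas are faulty, at most `r` are rollback-faulty, and at most `b` are benign.
`none` stands for an unknown threshold, which imposes no condition. -/
def FailuresWithin (k : ℕ) (r b : Option ℕ) : Prop :=
  {i | E.FaultyReplica i}.ncard ≤ k ∧
  (∀ r' ∈ r, {i | E.RollsBack i}.ncard ≤ r') ∧
  (∀ b' ∈ b, {i | E.BenignReplica i}.ncard ≤ b')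

/-! ### Fairness -/

/-- If two participants are up from time `t₀` on, then every message that one sends to the other from
`t₀` on is eventually delivered; and a local step of a participant that stays up does not remain
enabled forever without being taken. -/
def Fair : Prop :=
  (∀ p q t₀, (∀ t ≥ t₀, E.Up p t ∧ E.Up q t) →
    ∀ s ≥ t₀, ∀ m, E.Sends s p q m → ∃ t > s, E.ev t = .deliver p q m) ∧
  (∀ p t₀, (∀ t ≥ t₀, E.Up p t ∧ TickEnabled A (E.cfg t) p) → ∃ t ≥ t₀, E.ev t = .tick p)

/-! ### Operations; an operation is identified with the time of its invocation -/

def IsOp (s : ℕ) : Prop := ∃ c op, E.ev s = .invoke c op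

def IsRead (s : ℕ) : Prop := ∃ c, E.ev s = .invoke c .read

def IsWrite (s : ℕ) (v : V) : Prop := ∃ c, E.ev s = .invoke c (.write v)

/-- The operation invoked at time `s` returns `y` at time `t`: this is the first response of its
client since the invocation. -/
def Returns (s t : ℕ) (y : Resp V) : Prop :=
  ∃ c op, E.ev s = .invoke c op ∧ s ≤ t ∧ E.Responds t c y ∧
    ∀ t', s ≤ t' → t' < t → ∀ y', ¬ E.Responds t' c y'

def Complete (s : ℕ) : Prop := ∃ t y, E.Returns s t y

/-- The operation invoked at `s` completes before the one invoked at `s'` is invoked. -/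
def Precedes (s s' : ℕ) : Prop := ∃ t y, E.Returns s t y ∧ t < s'

/-- In the sequential order of the operations in `L` given by their positions `pos`, the last write
before the read `s` writes `v`, or there is no such write and `v` is the initial value. -/
def ReadsValue (v₀ : V) (L : Set ℕ) (pos : ℕ → ℕ) (s : ℕ) (v : V) : Prop :=
  (∃ w ∈ L, E.IsWrite w v ∧ pos w < pos s ∧
    ∀ w' ∈ L, ∀ v', E.IsWrite w' v' → pos w' < pos s → pos w' ≤ pos w) ∨
  (v = v₀ ∧ ∀ w ∈ L, ∀ v', E.IsWrite w v' → ¬ pos w < pos s)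

/-- Atomicity (linearizability) for a register with initial value `v₀`: every response belongs to an
invoked operation, and a set `L` of operations that contains all complete ones (and possibly some
incomplete ones) can be arranged in a sequence, by distinct positions `pos`, that respects real-time
precedence and in which the returned responses are those of a sequential register. -/
def Atomic (v₀ : V) : Prop :=
  (∀ t c y, E.Responds t c y → ∃ s, E.Returns s t y) ∧
  ∃ (L : Set ℕ) (pos : ℕ → ℕ),
    (∀ s ∈ L, E.IsOp s) ∧
    (∀ s, E.Complete s → s ∈ L) ∧
    Set.InjOn pos L ∧
    (∀ s ∈ L, ∀ s' ∈ L, E.Precedes s s' → pos s < pos s') ∧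
    (∀ s t y, E.Returns s t y →
      (∀ v, E.IsWrite s v → y = .ack) ∧
      (E.IsRead s → ∃ v, y = .value v ∧ E.ReadsValue v₀ L pos s v))

/-- Every operation invoked by a client that never crashes returns, whatever other clients do. -/
def WaitFree : Prop :=
  ∀ s c op, E.ev s = .invoke c op → ¬ E.Crashes (.cli c) → E.Complete s

/-! ### Message delays -/

/-- If `p` has an enabled local step after the event at time `t`, then it takes a local step at once
(at the same real time), `T t` being the real time of the event at time `t`. -/
def Prompt (T : ℕ → ℝ) (p : Proc n) (t : ℕ) : Prop :=
  TickEnabled A (E.cfg (t + 1)) p → ∃ t' > t, E.ev t' = .tick p ∧ T t' = T t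

/-- `p` is up during the `d` units of real time that follow the event at time `u`. -/
def UpThroughout (T : ℕ → ℝ) (u : ℕ) (d : ℝ) (p : Proc n) : Prop :=
  ∀ t ≥ u, T t ≤ T u + d → E.Up p t

/-- For the `d` units of real time that follow the event at time `u`, in which client `c` is up:
all but at most `k` replicas are up throughout; a message between participants that are up throughout
is delivered within one unit; and local computation takes no time: the participants that are up
throughout take their local step at once after each invocation or receipt, and so does `c` after
the event at time `u`. -/
def TimelyFrom (T : ℕ → ℝ) (k : ℕ) (c : ℕ) (u : ℕ) (d : ℝ) : Prop :=
  E.UpThroughout T u d (.cli c) ∧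
  n ≤ {i : Fin n | E.UpThroughout T u d (.rep i)}.ncard + k ∧
  (∀ p q, E.UpThroughout T u d p → E.UpThroughout T u d q →
    ∀ s ≥ u, T s ≤ T u + d → ∀ m, E.Sends s p q m →
      ∃ t > s, E.ev t = .deliver p q m ∧ T t ≤ T s + 1) ∧
  (∀ p, E.UpThroughout T u d p → ∀ s ≥ u, T s ≤ T u + d →
    (∃ src m, E.ev s = .deliver src p m) ∨ (∃ c' op, p = .cli c' ∧ E.ev s = .invoke c' op) →
    E.Prompt T p s) ∧
  E.Prompt T (.cli c) u

/-- Every message that is delivered was in transit for at least one unit of real time. -/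
def SlowChannels (T : ℕ → ℝ) : Prop :=
  ∀ t src dst m, E.ev t = .deliver src dst m → ∃ s < t, E.Sends s src dst m ∧ T s + 1 ≤ T t

end Execution

section Correctness

variable {n : ℕ} {V : Type u} (A : Implementation n V)

/-- `A` is a `k`-tolerant implementation of an atomic wait-free register with initial value `v₀`,
which all clients may read and write: it is correct in all executions that satisfy the bounds on the
failures of the replicas; any number of clients may crash.  Fairness is needed for wait freedom only. -/
def IsTolerantAtomicWaitFree (v₀ : V) (k : ℕ) (r b : Option ℕ) : Prop :=
  ∀ E : Execution A, E.FailuresWithin k r b → E.Atomic v₀ ∧ (E.Fair → E.WaitFree)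

/-- The time complexity of (reads and writes of) `A` is `d` message delays, for any assignment `T` of
real times to the events.
Upper bound: if from time `u` on (for instance, from the invocation on) all but `k` replicas are up,
a message takes at most one unit of time and local computation takes none, then an operation that was
invoked at time `u` or before returns within `d` units from `u`.
Lower bound: if each message takes at least one unit of time, then no operation returns sooner than
`d` units after its invocation. -/
def HasTimeComplexity (k : ℕ) (r b : Option ℕ) (d : ℕ) : Prop :=
  ∀ E : Execution A, E.FailuresWithin k r b → ∀ T : ℕ → ℝ, Monotone T →
    (∀ s c op u, E.ev s = .invoke c op → s ≤ u → E.TimelyFrom T k c u d →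
      ∃ t y, E.Returns s t y ∧ T t ≤ T u + d) ∧
    (E.SlowChannels T → ∀ s t y, E.Returns s t y → T s + d ≤ T t)

end Correctness

/-! ## The algorithm -/

/-- Timestamps: counter and client identifier, ordered lexicographically. -/
abbrev Timestamp : Type := ℕ ×ₗ ℕ

/-- Globally unique request identifiers: the client, and a local counter of the client. -/
abbrev ReqId : Type := ℕ × ℕ

/-- What `READ` asks for: the timestamp, or the timestamp and the value. -/
inductive ReadReq : Type
  | ts
  | tsVal

inductive ReadVal (V : Type u) : Type u
  | ts (t : Timestamp)
  | tsVal (t : Timestamp) (v : V)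

def ReadVal.timestamp {V : Type u} : ReadVal V → Timestamp
  | .ts t => t
  | .tsVal t _ => t

def ReadVal.pair? {V : Type u} : ReadVal V → Option (Timestamp × V)
  | .ts _ => none
  | .tsVal t v => some (t, v)

/-- Messages `READ(id, req)`, `READ_ACK(id, x, j)`, `WRITE(id, TSVal(t, v))`, `WRITE_ACK(id, j)`. -/
inductive RegMsg (n : ℕ) (V : Type u) : Type u
  | read (id : ReqId) (req : ReadReq)
  | readAck (id : ReqId) (x : ReadVal V) (j : Fin n)
  | write (id : ReqId) (t : Timestamp) (v : V)
  | writeAck (id : ReqId) (j : Fin n)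

/-- Where a client is in its current operation: between operations; in `read_quorum`, with the answers
received so far; or in `write_quorum`, with the set of replicas whose acknowledgement was received and
the response that the operation will return. -/
inductive Phase (n : ℕ) (V : Type u) : Type u
  | idle
  | readQuorum (op : Op V) (id : ReqId) (acks : Fin n → Option (ReadVal V))
  | writeQuorum (id : ReqId) (t : Timestamp) (v : V) (acks : Finset (Fin n)) (result : Resp V)

structure RegClient (n : ℕ) (V : Type u) : Type u where
  nextId : ℕ
  phase : Phase n V

structure RegReplica (V : Type u) : Type u where
  ts : Timestamp
  val : V
  stale : Bool

/-- The predicate `2k + r + 1 ≤ n < 2k + b + 1`. -/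
abbrev P (n k r b : ℕ) : Prop := 2 * k + r + 1 ≤ n ∧ n < 2 * k + b + 1

def writeQuorumSize (n k : ℕ) : ℕ := n - k

def readQuorumSize (n k r b : ℕ) : ℕ := if P n k r b then n - k else k + 1

/-- The replicas that keep their state in non-volatile storage: the first `2k + r + 1` of the set `S`
of those equipped with it if `P` holds, and none otherwise. -/
abbrev Persists {n : ℕ} (k r b : ℕ) (S : Finset (Fin n)) (i : Fin n) : Prop :=
  P n k r b ∧ i ∈ S ∧ (S.filter (· < i)).card < 2 * k + r + 1

section Algorithm

variable {n : ℕ} {V : Type u}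

def broadcast (m : RegMsg n V) : List (Proc n × RegMsg n V) :=
  (List.finRange n).map fun i => (Proc.rep i, m)

def requestOf : Op V → ReadReq
  | .read => .tsVal
  | .write _ => .ts

/-- The answers collected from the replicas. -/
def answers (acks : Fin n → Option (ReadVal V)) : List (ReadVal V) :=
  (List.finRange n).filterMap acks

/-- What client `c` (that is, participant number `n + 1 + c`) passes to `write_quorum`, and the
response that it returns afterwards.  The default `((0, 0), v₀)` is never used if quorums are
nonempty. -/
def choose (v₀ : V) (c : ℕ) (acks : Fin n → Option (ReadVal V)) :
    Op V → Timestamp × V × Resp V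
  | .write v =>
      let cnt := ((answers acks).map fun x => (ofLex x.timestamp).1).foldr max 0
      (toLex (cnt + 1, n + 1 + c), v, .ack)
  | .read =>
      let x := (((answers acks).filterMap ReadVal.pair?).argmax Prod.fst).getD (toLex (0, 0), v₀)
      (x.1, x.2, .value x.2)

/-- The client automaton.  Receipts are recorded; the local step leaves the current waiting loop if a
quorum has answered, and (re)transmits the request otherwise.  On leaving `read_quorum`, the request
of `write_quorum` is transmitted in the same step. -/
def clientStep (v₀ : V) (qw qr : ℕ) (c : ℕ) (inp : ClientInput n V (RegMsg n V))
    (σ : RegClient n V) : ClientResult n V (RegMsg n V) (RegClient n V) :=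
  match inp, σ.phase with
  | .invoke op, .idle =>
      ⟨{ nextId := σ.nextId + 1, phase := .readQuorum op (c, σ.nextId) fun _ => none }, [], none⟩
  | .recv _ (.readAck id x j), .readQuorum op id' acks =>
      if id = id' ∧ acks j = none then
        ⟨{ σ with phase := .readQuorum op id' (Function.update acks j (some x)) }, [], none⟩
      else ⟨σ, [], none⟩
  | .recv _ (.writeAck id j), .writeQuorum id' t v acks y =>
      if id = id' then ⟨{ σ with phase := .writeQuorum id' t v (insert j acks) y }, [], none⟩
      else ⟨σ, [], none⟩
  | .tick, .readQuorum op id acks =>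
      if qr ≤ (Finset.univ.filter fun j => (acks j).isSome).card then
        let (t, v, y) := choose v₀ c acks op
        ⟨{ nextId := σ.nextId + 1, phase := .writeQuorum (c, σ.nextId) t v ∅ y },
          broadcast (.write (c, σ.nextId) t v), none⟩
      else ⟨σ, broadcast (.read id (requestOf op)), none⟩
  | .tick, .writeQuorum id t v acks y =>
      if qw ≤ acks.card then ⟨{ σ with phase := .idle }, [], some y⟩
      else ⟨σ, broadcast (.write id t v), none⟩
  | _, _ => ⟨σ, [], none⟩

/-- The replica automaton.  A stale replica never stops being stale while it is up, so that a `READ`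
request for which the precondition `¬ stale` fails remains unanswered. -/
def replicaStep (i : Fin n) (inp : ReplicaInput n (RegMsg n V)) (σ : RegReplica V) :
    ReplicaResult n (RegMsg n V) (RegReplica V) :=
  match inp with
  | .recv src (.read id req) =>
      if σ.stale then ⟨σ, []⟩
      else
        let x : ReadVal V := match req with
          | .ts => .ts σ.ts
          | .tsVal => .tsVal σ.ts σ.val
        ⟨σ, [(src, .readAck id x i)]⟩
  | .recv src (.write id t v) =>
      ⟨if σ.ts < t then { σ with ts := t, val := v } else σ, [(src, .writeAck id i)]⟩
  | _ => ⟨σ, []⟩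

def initialReplica (v₀ : V) : RegReplica V := ⟨toLex (0, 0), v₀, false⟩

/-- The algorithm for known thresholds. -/
def algorithmKnown (v₀ : V) (k r b : ℕ) (S : Finset (Fin n)) : Implementation n V where
  Msg := RegMsg n V
  ClientState := RegClient n V
  ReplicaState := RegReplica V
  Stable := Option (RegReplica V)
  clientInit := fun _ => ⟨0, .idle⟩
  clientStep := clientStep v₀ (writeQuorumSize n k) (readQuorumSize n k r b)
  replicaInit := fun _ => initialReplica v₀
  replicaStep := replicaStep
  stable := fun i σ => if Persists k r b S i then some σ else none
  onRestart := fun _ γ =>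
    let σ := γ.getD (initialReplica v₀)
    ⟨if P n k r b then σ else { σ with stale := true }, []⟩

/-- The algorithm, for `n` replicas of which those in `S` have non-volatile storage.  An unknown
threshold (`none`) is replaced by its largest possible value: `k` for `r`, and `n` for `b`. -/
def algorithm (v₀ : V) (k : ℕ) (r b : Option ℕ) (S : Finset (Fin n)) : Implementation n V :=
  algorithmKnown v₀ k (r.getD k) (b.getD n) S

end Algorithm

end CRR

/-!
Every operation runs `read_quorum` and then `write_quorum` once, and in between it chooses a timestamp
and a value.  The theorem rests on the way in which quorums of the two kinds meet.

*Safety.*  Each write quorum meets each read quorum in a replica whose timestamp does not decrease as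
long as it answers `READ` requests (`Execution.quorumsMeet`, `Execution.ts_mono`).  If `P` fails, any
common replica will do, because a replica that has restarted is stale and no longer answers.  If `P`
holds, at most `2 * k` of the `2 * k + r + 1` replicas with persistent state are missed by one of the two
quorums, and at most `r` of them roll back, so that one is left in both quorums whose state only grows.
Hence an operation that starts after another one has returned chooses no smaller timestamp, and a larger
one if it is a write (`Execution.Chooses.le_of_returns`); in particular distinct writes choose distinct
timestamps.  Moreover a read only returns a pair that some write has chosen, or the initial one
(`Execution.legit_rp`).  Ordering the operations by timestamp, each write before the reads that return
it, and these by the time of invocation, is therefore a linearization.  A write that never returns takes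
part in it only if some complete operation has its timestamp; then each operation has only finitely many
predecessors (`Execution.finite_key_lt`), and the order can be numbered by natural numbers.

*Liveness.*  A client in the middle of an operation always has an enabled local step, at which it moves
on if a quorum has answered and sends its current request again otherwise.  Two message delays after it
sends `READ` it has all answers that `read_quorum` needs
and moves on, and two delays after that it returns (`Execution.Timely.exists_responds`).  Enough replicas
answer `READ`: if `P` holds none is ever stale, and otherwise at least `n - k - b ≥ k + 1` replicas never
crash (`Execution.exists_readers`).  Wait freedom and the upper bound on the time complexity are two
instances of this argument, with different meanings of "within a delay".

*Lower bound.*  Request identifiers are fresh, so a request is sent no earlier than its phase begins, and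
each of the two phases has to wait for a round trip (`Execution.le_of_slowChannels`).
-/

namespace CRR

universe u

variable {n : ℕ} {V : Type u} {v₀ : V} {k r b : ℕ} {S : Finset (Fin n)}

/-! ### Events as inputs of automata -/

/-- The input that the event hands to client `c`, if any. -/
def Event.clientInput {Msg : Type u} (c : ℕ) : Event n V Msg → Option (ClientInput n V Msg)
  | .invoke c' op => if c' = c then some (.invoke op) else none
  | .deliver src (.cli c') m => if c' = c then some (.recv src m) else none
  | .tick (.cli c') => if c' = c then some .tick else none
  | _ => none

theorem Execution.client_of_clientInput_eq_none {A : Implementation n V} (E : Execution A) {c t : ℕ}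
    (h : (E.ev t).clientInput c = none) :
    (E.cfg (t + 1)).client c = (E.cfg t).client c ∧ (∀ y, ¬ E.Responds t c y) ∧
      (E.cfg (t + 1)).busy c = (E.cfg t).busy c := by
  rw [E.next t]
  unfold Responds
  generalize E.ev t = e at h
  rcases e with _ | ⟨c', op⟩ | ⟨src, i | c', m⟩ | (i | c') | p | i | ⟨i, s⟩ <;>
    simp only [Event.clientInput, ite_eq_right_iff, reduceCtorEq, imp_false] at h <;>
    first
    | (simp [step, stepReplica, stepRestart]; done)
    | simp [step, stepClient, h, Ne.symm h]

theorem Execution.client_of_clientInput_eq_some {A : Implementation n V} (E : Execution A) {c t : ℕ}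
    {inp : ClientInput n V A.Msg} (h : (E.ev t).clientInput c = some inp) :
    (E.cfg (t + 1)).client c = (A.clientStep c inp ((E.cfg t).client c)).state ∧
      (∀ y, E.Responds t c y ↔ (A.clientStep c inp ((E.cfg t).client c)).resp = some y) ∧
      ((E.cfg (t + 1)).busy c = true ↔ ((E.cfg t).busy c = true ∨ ∃ op, E.ev t = .invoke c op) ∧
        (A.clientStep c inp ((E.cfg t).client c)).resp = none) ∧
      ∀ x m, E.Sends t (.cli c) x m ↔ (x, m) ∈ (A.clientStep c inp ((E.cfg t).client c)).send := by
  rw [E.next t]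
  unfold Responds Sends
  generalize E.ev t = e at h
  rcases e with _ | ⟨c', op⟩ | ⟨src, i | c', m⟩ | (i | c') | p | i | ⟨i, s⟩ <;>
    simp only [Event.clientInput, Option.ite_none_right_eq_some, Option.some.injEq, reduceCtorEq]
      at h <;>
    obtain ⟨rfl, rfl⟩ := h <;>
    simp [step, stepClient]

theorem Execution.clientInput_of_sends {A : Implementation n V} (E : Execution A) {c t : ℕ}
    {x : Proc n} {m : A.Msg} (h : E.Sends t (.cli c) x m) :
    ∃ inp, (E.ev t).clientInput c = some inp := by
  unfold Sends at h
  generalize E.ev t = e at h ⊢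
  rcases e with _ | ⟨c', op⟩ | ⟨src, i | c', m⟩ | (i | c') | p | i | ⟨i, s⟩ <;>
    simp only [step, stepClient, stepReplica, stepRestart, List.mem_map, Prod.mk.injEq,
      Proc.cli.injEq, reduceCtorEq, false_and, and_false, exists_false, List.not_mem_nil] at h <;>
    obtain ⟨_, -, rfl, -⟩ := h <;>
    simp [Event.clientInput]

/-- The input that the event hands to replica `i`, if any. -/
def Event.replicaInput {Msg : Type u} (i : Fin n) : Event n V Msg → Option (ReplicaInput n Msg)
  | .deliver src (.rep j) m => if j = i then some (.recv src m) else none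
  | .tick (.rep j) => if j = i then some .tick else none
  | _ => none

theorem Execution.replica_of_replicaInput_eq_some {A : Implementation n V} (E : Execution A)
    {i : Fin n} {t : ℕ} {inp : ReplicaInput n A.Msg} (h : (E.ev t).replicaInput i = some inp) :
    (E.cfg (t + 1)).replica i = (A.replicaStep i inp ((E.cfg t).replica i)).state ∧
      ∀ x m, E.Sends t (.rep i) x m ↔ (x, m) ∈ (A.replicaStep i inp ((E.cfg t).replica i)).send := by
  rw [E.next t]
  unfold Sends
  generalize E.ev t = e at h
  rcases e with _ | ⟨c', op⟩ | ⟨src, i | c', m⟩ | (i | c') | p | i | ⟨i, s⟩ <;>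
    simp only [Event.replicaInput, Option.ite_none_right_eq_some, Option.some.injEq, reduceCtorEq]
      at h <;>
    obtain ⟨rfl, rfl⟩ := h <;>
    simp [step, stepReplica]

theorem Execution.replica_of_replicaInput_eq_none {A : Implementation n V} (E : Execution A)
    {i : Fin n} {t : ℕ} (h : (E.ev t).replicaInput i = none) :
    (E.cfg (t + 1)).replica i = (E.cfg t).replica i ∨
    (E.ev t = .restart i ∧
      (E.cfg (t + 1)).replica i = (A.onRestart i (A.stable i ((E.cfg t).replica i))).state) ∨
    ∃ s, E.ev t = .rollback i s ∧ s < t ∧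
      (E.cfg (t + 1)).replica i = (A.onRestart i (A.stable i ((E.cfg s).replica i))).state := by
  have ha := E.allowed t
  rw [E.next t]
  generalize E.ev t = e at h ha
  rcases e with _ | ⟨c', op⟩ | ⟨src, j | c', m⟩ | (j | c') | p | j | ⟨j, s⟩ <;>
    simp only [Event.replicaInput, ite_eq_right_iff, reduceCtorEq, imp_false] at h <;>
    first
    | left; simp [step, stepClient]; done
    | left; simp [step, stepReplica, Ne.symm h]
    | by_cases hj : j = i
      · subst hj
        have hs := ha.2
        right
        simp [step, stepRestart, hs]
      · left
        simp [step, stepRestart, Ne.symm hj]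
    | by_cases hj : j = i
      · subst hj
        right
        simp [step, stepRestart]
      · left
        simp [step, stepRestart, Ne.symm hj]

theorem Execution.sends_rep {A : Implementation n V} (E : Execution A) {i : Fin n} {t : ℕ}
    {x : Proc n} {m : A.Msg} (h : E.Sends t (.rep i) x m) :
    (∃ inp, (E.ev t).replicaInput i = some inp) ∨ ∃ γ, (x, m) ∈ (A.onRestart i γ).send := by
  unfold Sends at h
  generalize E.ev t = e at h ⊢
  rcases e with _ | ⟨c', op⟩ | ⟨src, i | c', m⟩ | (i | c') | p | i | ⟨i, s⟩ <;>
    simp only [step, stepClient, stepReplica, stepRestart, List.mem_map, Prod.mk.injEq,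
      Proc.rep.injEq, reduceCtorEq, false_and, and_false, exists_false, List.not_mem_nil] at h <;>
    obtain ⟨_, h, rfl, rfl⟩ := h <;>
    first
    | exact .inr ⟨_, h⟩
    | simp [Event.replicaInput]

/-! ### Steps of the two automata -/

/-- What a replica in state `σ` answers to a `READ` request. -/
def ReadReq.answer (σ : RegReplica V) : ReadReq → ReadVal V
  | .ts => .ts σ.ts
  | .tsVal => .tsVal σ.ts σ.val

/-- The effect of the event `e` on the client `c`: its state changes from the first to the second
argument, and the last argument is the response that it returns, if any.  The hypotheses of `stay` say
that none of the other moves is possible. -/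
inductive ClientMove (v₀ : V) (qw qr c : ℕ) (e : Event n V (RegMsg n V)) :
    RegClient n V → RegClient n V → Option (Resp V) → Prop
  | stay (σ) (hw : ∀ id t v acks y, e = .tick (.cli c) → σ.phase = .writeQuorum id t v acks y →
        acks.card < qw)
      (hr : ∀ op id acks, e = .tick (.cli c) → σ.phase = .readQuorum op id acks →
        (Finset.univ.filter fun j => (acks j).isSome).card < qr)
      (hra : ∀ src id x j op acks, e = .deliver src (.cli c) (.readAck id x j) →
        σ.phase = .readQuorum op id acks → (acks j).isSome)
      (hwa : ∀ src id j t v acks y, e = .deliver src (.cli c) (.writeAck id j) →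
        σ.phase ≠ .writeQuorum id t v acks y)
      (hi : ∀ op, e = .invoke c op → σ.phase ≠ .idle) : ClientMove v₀ qw qr c e σ σ none
  | invoke (op m) (he : e = .invoke c op) :
      ClientMove v₀ qw qr c e ⟨m, .idle⟩ ⟨m + 1, .readQuorum op (c, m) fun _ => none⟩ none
  | readAck (src m op id x j acks) (he : e = .deliver src (.cli c) (.readAck id x j))
      (hj : acks j = none) :
      ClientMove v₀ qw qr c e ⟨m, .readQuorum op id acks⟩
        ⟨m, .readQuorum op id (Function.update acks j (some x))⟩ none
  | writeAck (src m id t v acks y j) (he : e = .deliver src (.cli c) (.writeAck id j)) :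
      ClientMove v₀ qw qr c e ⟨m, .writeQuorum id t v acks y⟩
        ⟨m, .writeQuorum id t v (insert j acks) y⟩ none
  | switch (m op id acks t v y) (he : e = .tick (.cli c))
      (hq : qr ≤ (Finset.univ.filter fun j => (acks j).isSome).card)
      (hc : choose v₀ c acks op = (t, v, y)) :
      ClientMove v₀ qw qr c e ⟨m, .readQuorum op id acks⟩ ⟨m + 1, .writeQuorum (c, m) t v ∅ y⟩ none
  | finish (m id t v acks y) (he : e = .tick (.cli c)) (hq : qw ≤ acks.card) :
      ClientMove v₀ qw qr c e ⟨m, .writeQuorum id t v acks y⟩ ⟨m, .idle⟩ (some y)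

theorem clientMove_tick (qw qr c : ℕ) (σ : RegClient n V) :
    ClientMove v₀ qw qr c (.tick (.cli c)) σ (clientStep v₀ qw qr c .tick σ).state
      (clientStep v₀ qw qr c .tick σ).resp := by
  obtain ⟨m, ph⟩ := σ
  cases ph with
  | idle => exact .stay _ (by simp) (by simp) (by simp) (by simp) (by simp)
  | readQuorum op id acks =>
    by_cases hq : qr ≤ (Finset.univ.filter fun j => (acks j).isSome).card
    · simpa [clientStep, hq] using .switch m op id acks _ _ _ rfl hq rfl
    · simp only [clientStep, hq, if_false]
      refine .stay _ (by simp) ?_ (by simp) (by simp) (by simp)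
      rintro _ _ _ - h
      simp only [Phase.readQuorum.injEq] at h
      obtain ⟨rfl, rfl, rfl⟩ := h
      exact not_le.1 hq
  | writeQuorum id t v acks y =>
    by_cases hq : qw ≤ acks.card
    · simpa [clientStep, hq] using .finish m id t v acks y rfl hq
    · simp only [clientStep, hq, if_false]
      refine .stay _ ?_ (by simp) (by simp) (by simp) (by simp)
      rintro _ _ _ _ _ - h
      simp only [Phase.writeQuorum.injEq] at h
      obtain ⟨rfl, rfl, rfl, rfl, rfl⟩ := h
      exact not_le.1 hq

theorem clientMove_recv (qw qr c : ℕ) (src : Proc n) (msg : RegMsg n V) (σ : RegClient n V) :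
    ClientMove v₀ qw qr c (.deliver src (.cli c) msg) σ
      (clientStep v₀ qw qr c (.recv src msg) σ).state
      (clientStep v₀ qw qr c (.recv src msg) σ).resp := by
  obtain ⟨m, ph⟩ := σ
  cases msg with
  | read id req =>
    cases ph <;> exact .stay _ (by simp) (by simp) (by simp) (by simp) (by simp)
  | write id t v =>
    cases ph <;> exact .stay _ (by simp) (by simp) (by simp) (by simp) (by simp)
  | readAck id x j =>
    cases ph with
    | idle => exact .stay _ (by simp) (by simp) (by simp) (by simp) (by simp)
    | writeQuorum id t v acks y => exact .stay _ (by simp) (by simp) (by simp) (by simp) (by simp)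
    | readQuorum op id' acks =>
      by_cases hq : id = id' ∧ acks j = none
      · obtain ⟨rfl, hj⟩ := hq
        simpa [clientStep, hj] using .readAck src m op id x j acks rfl hj
      · simp only [clientStep, hq, if_false]
        refine .stay _ (by simp) (by simp) ?_ (by simp) (by simp)
        rintro _ _ _ _ _ _ h h'
        simp only [Phase.readQuorum.injEq] at h'
        obtain ⟨rfl, rfl, rfl⟩ := h'
        simp only [Event.deliver.injEq, RegMsg.readAck.injEq] at h
        obtain ⟨-, -, rfl, rfl, rfl⟩ := h
        rw [← Option.ne_none_iff_isSome]
        tauto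
  | writeAck id j =>
    cases ph with
    | idle => exact .stay _ (by simp) (by simp) (by simp) (by simp) (by simp)
    | readQuorum op id acks => exact .stay _ (by simp) (by simp) (by simp) (by simp) (by simp)
    | writeQuorum id' t v acks y =>
      by_cases hq : id = id'
      · subst hq
        simpa [clientStep] using .writeAck src m id t v acks y j rfl
      · simp only [clientStep, hq, if_false]
        refine .stay _ (by simp) (by simp) (by simp) ?_ (by simp)
        rintro _ _ _ _ _ _ _ h h'
        simp only [Phase.writeQuorum.injEq] at h'
        obtain ⟨rfl, -⟩ := h'
        simp only [Event.deliver.injEq, RegMsg.writeAck.injEq] at h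
        exact hq h.2.2.1

theorem clientMove_invoke (qw qr c : ℕ) (op : Op V) (σ : RegClient n V) :
    ClientMove v₀ qw qr c (.invoke c op) σ (clientStep v₀ qw qr c (.invoke op) σ).state
      (clientStep v₀ qw qr c (.invoke op) σ).resp := by
  obtain ⟨m, ph⟩ := σ
  cases ph with
  | idle => exact .invoke op m rfl
  | readQuorum op id acks => exact .stay _ (by simp) (by simp) (by simp) (by simp) (by simp)
  | writeQuorum id t v acks y => exact .stay _ (by simp) (by simp) (by simp) (by simp) (by simp)

namespace Execution

variable (E : Execution (algorithmKnown v₀ k r b S))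

/-- The event at time `t`, with the type of messages spelled out. -/
def act (t : ℕ) : Event n V (RegMsg n V) := E.ev t

/-- The state of client `c` at time `t`. -/
def cl (c t : ℕ) : RegClient n V := (E.cfg t).client c

/-- The state of replica `i` at time `t`. -/
def rp (i : Fin n) (t : ℕ) : RegReplica V := (E.cfg t).replica i

theorem rp_zero (i : Fin n) : E.rp i 0 = initialReplica v₀ := by
  simp only [rp, E.init]; rfl

theorem cl_zero (c : ℕ) : E.cl c 0 = ⟨0, .idle⟩ := by
  simp only [cl, E.init]; rfl

/-- Every event moves every client as described by `ClientMove`. -/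
theorem exists_clientMove (c t : ℕ) : ∃ o : Option (Resp V),
    ClientMove v₀ (n - k) (readQuorumSize n k r b) c (E.act t) (E.cl c t) (E.cl c (t + 1)) o ∧
    (∀ y, E.Responds t c y ↔ o = some y) ∧
    ((E.cfg (t + 1)).busy c = true ↔
      ((E.cfg t).busy c = true ∨ ∃ op, E.act t = .invoke c op) ∧ o = none) := by
  cases h : (E.act t).clientInput c with
  | none =>
    obtain ⟨h1, h2, h3⟩ := E.client_of_clientInput_eq_none h
    have h4 : ∀ op, E.act t ≠ .invoke c op := by
      intro op h'; simp [h', Event.clientInput] at h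
    refine ⟨none, ?_, by simpa using h2, ?_⟩
    · rw [show E.cl c (t + 1) = E.cl c t from h1]
      refine .stay _ ?_ ?_ ?_ ?_ fun op h' => absurd h' (h4 op) <;>
      · intros
        simp_all [Event.clientInput]
    · rw [h3]; simp [h4]
  | some inp =>
    obtain ⟨h1, h2, h3, -⟩ := E.client_of_clientInput_eq_some h
    refine ⟨_, ?_, h2, h3⟩
    rw [show E.cl c (t + 1) = _ from h1]
    change ClientMove v₀ (n - k) (readQuorumSize n k r b) c (E.act t) (E.cl c t)
      (clientStep v₀ (n - k) (readQuorumSize n k r b) c inp (E.cl c t)).state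
      (clientStep v₀ (n - k) (readQuorumSize n k r b) c inp (E.cl c t)).resp
    generalize E.act t = e at h ⊢
    rcases e with _ | ⟨c', op⟩ | ⟨src, i | c', m⟩ | (i | c') | p | i | ⟨i, s⟩ <;>
      simp only [Event.clientInput, Option.ite_none_right_eq_some, Option.some.injEq, reduceCtorEq]
        at h <;>
      obtain ⟨rfl, rfl⟩ := h
    · exact clientMove_invoke ..
    · exact clientMove_recv ..
    · exact clientMove_tick ..

/-! ### Messages -/

theorem clientInput_tick (c : ℕ) :
    (Event.tick (.cli c) : Event n V (RegMsg n V)).clientInput c = some .tick := by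
  simp [Event.clientInput]

/-- What a client sends in a local step is determined by its phase after the step. -/
theorem sends_cli_iff {c t : ℕ} {dst : Proc n} {m : RegMsg n V} :
    E.Sends t (.cli c) dst m ↔ E.act t = .tick (.cli c) ∧ (∃ j, dst = .rep j) ∧
      ((∃ op id acks, (E.cl c (t + 1)).phase = .readQuorum op id acks ∧
        m = .read id (requestOf op)) ∨
      ∃ id ts v acks y, (E.cl c (t + 1)).phase = .writeQuorum id ts v acks y ∧
        m = .write id ts v) := by
  have aux : ∀ inp, (E.act t).clientInput c = some inp → (E.Sends t (.cli c) dst m ↔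
      (dst, m) ∈ (clientStep v₀ (n - k) (readQuorumSize n k r b) c inp (E.cl c t)).send) := by
    intro inp h
    exact (E.client_of_clientInput_eq_some h).2.2.2 dst m
  have aux' : ∀ inp, (E.act t).clientInput c = some inp → E.cl c (t + 1) =
      (clientStep v₀ (n - k) (readQuorumSize n k r b) c inp (E.cl c t)).state := by
    intro inp h
    exact (E.client_of_clientInput_eq_some h).1
  by_cases ht : E.act t = .tick (.cli c)
  · have h := clientInput_tick (n := n) (V := V) c
    rw [← ht] at h
    rw [aux _ h, aux' _ h]
    simp only [ht, true_and]
    generalize E.cl c t = σ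
    obtain ⟨m', ph⟩ := σ
    cases ph with
    | idle => simp [clientStep]
    | readQuorum op id acks =>
      by_cases hq : readQuorumSize n k r b ≤ (Finset.univ.filter fun j => (acks j).isSome).card
      · simp only [clientStep, hq, if_true, broadcast, List.mem_map]
        grind
      · simp only [clientStep, hq, if_false, broadcast, List.mem_map]
        grind
    | writeQuorum id t v acks y =>
      by_cases hq : n - k ≤ acks.card
      · simp [clientStep, hq]
      · simp only [clientStep, hq, if_false, broadcast, List.mem_map]
        grind
  · constructor
    · intro hs
      exfalso
      obtain ⟨inp, h⟩ : ∃ inp : ClientInput n V (RegMsg n V),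
        (E.act t).clientInput c = some inp := E.clientInput_of_sends hs
      rw [aux _ h] at hs
      generalize E.act t = e at h ht
      rcases e with _ | ⟨c', op⟩ | ⟨src, i | c', m⟩ | (i | c') | p | i | ⟨i, s⟩ <;>
        simp only [Event.clientInput, Option.ite_none_right_eq_some, Option.some.injEq,
          reduceCtorEq] at h <;>
        obtain ⟨rfl, rfl⟩ := h
      · generalize E.cl c' t = σ at hs
        obtain ⟨m', ph⟩ := σ
        cases ph <;> simp [clientStep] at hs
      · generalize E.cl c' t = σ at hs
        obtain ⟨m', ph⟩ := σ
        cases ph <;> cases m <;> simp only [clientStep, List.not_mem_nil] at hs <;>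
          split_ifs at hs <;> simp at hs
      · exact ht rfl
    · exact fun h => absurd h.1 ht

/-- A replica only answers requests. -/
theorem sends_rep_iff {i : Fin n} {t : ℕ} {dst : Proc n} {m : RegMsg n V} :
    E.Sends t (.rep i) dst m ↔
      (∃ id req, E.act t = .deliver dst (.rep i) (.read id req) ∧ (E.rp i t).stale = false ∧
        m = .readAck id (req.answer (E.rp i t)) i) ∨
      ∃ id ts v, E.act t = .deliver dst (.rep i) (.write id ts v) ∧ m = .writeAck id i := by
  have aux : ∀ inp, (E.act t).replicaInput i = some inp → (E.Sends t (.rep i) dst m ↔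
      (dst, m) ∈ (CRR.replicaStep i inp (E.rp i t)).send) := by
    intro inp h
    exact (E.replica_of_replicaInput_eq_some h).2 dst m
  cases h : (E.act t).replicaInput i with
  | none =>
    constructor
    · intro hs
      obtain ⟨inp, h'⟩ | ⟨γ, h'⟩ := E.sends_rep hs
      · change (E.act t).replicaInput i = some inp at h'
        simp [h] at h'
      · exact absurd h' (List.not_mem_nil)
    · rintro (⟨id, req, h', -⟩ | ⟨id, ts, v, h', -⟩) <;> simp [h', Event.replicaInput] at h
  | some inp =>
    rw [aux _ h]
    generalize E.act t = e at h
    rcases e with _ | ⟨c', op⟩ | ⟨src, i | c', m⟩ | (i | c') | p | i | ⟨i, s⟩ <;>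
      simp only [Event.replicaInput, Option.ite_none_right_eq_some, Option.some.injEq,
        reduceCtorEq] at h <;>
      obtain ⟨rfl, rfl⟩ := h
    · cases m with
      | read id req =>
        cases hst : (E.rp i t).stale <;> cases req <;>
          simp [CRR.replicaStep, hst, ReadReq.answer] <;> grind
      | write id ts v => simp [CRR.replicaStep]; grind
      | _ => simp [CRR.replicaStep]
    · simp [CRR.replicaStep]

theorem exists_sends_of_act_deliver {t : ℕ} {src dst : Proc n} {m : RegMsg n V}
    (h : E.act t = .deliver src dst m) : ∃ s < t, E.Sends s src dst m := by
  have := E.allowed t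
  rw [show E.ev t = .deliver src dst m from h] at this
  exact this.2

/-! ### Replicas -/

/-- The steps of a replica.  A restart without usable storage resets its variables, and makes it
stale unless the condition `P` holds. -/
inductive ReplicaMove (i : Fin n) (t : ℕ) : Prop
  | same (h : E.rp i (t + 1) = E.rp i t)
  | adopt (src id ts v) (he : E.act t = .deliver src (.rep i) (.write id ts v))
      (h : E.rp i (t + 1) =
        if (E.rp i t).ts < ts then { E.rp i t with ts := ts, val := v } else E.rp i t)
  | reset (hu : ¬ E.Up (.rep i) t) (hp : ¬ Persists k r b S i) (h : E.rp i (t + 1) =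
        if P n k r b then initialReplica v₀ else { initialReplica v₀ with stale := true })
  | back (s) (he : E.act t = .rollback i s) (hs : s < t) (hp : Persists k r b S i)
      (h : E.rp i (t + 1) = E.rp i s)

theorem replicaMove (i : Fin n) (t : ℕ) : E.ReplicaMove i t := by
  cases h : (E.act t).replicaInput i with
  | none =>
    have aux : ∀ s, ((algorithmKnown v₀ k r b S).onRestart i
        ((algorithmKnown v₀ k r b S).stable i ((E.cfg s).replica i))).state =
        if Persists k r b S i then E.rp i s else
          if P n k r b then initialReplica v₀ else { initialReplica v₀ with stale := true } := by
      intro s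
      change (if P n k r b then (if Persists k r b S i then some (E.rp i s) else none).getD
        (initialReplica v₀) else { (if Persists k r b S i then some (E.rp i s) else none).getD
        (initialReplica v₀) with stale := true}) = _
      by_cases hp : Persists k r b S i
      · simp only [if_pos hp, if_pos hp.1, Option.getD_some]
      · simp [hp]
    have ha := E.allowed t
    obtain h' | ⟨he, h'⟩ | ⟨s, he, hs, h'⟩ := E.replica_of_replicaInput_eq_none h
    · exact .same h'
    · rw [aux] at h'
      by_cases hp : Persists k r b S i
      · rw [if_pos hp] at h'
        exact .same h'
      · rw [if_neg hp] at h'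
        rw [he] at ha
        exact .reset (by simp [Up, show (E.cfg t).up (.rep i) = false from ha]) hp h'
    · rw [aux] at h'
      by_cases hp : Persists k r b S i
      · rw [if_pos hp] at h'
        exact .back s he hs hp h'
      · rw [if_neg hp] at h'
        rw [he] at ha
        exact .reset (by simp [Up, ha.1]) hp h'
  | some inp =>
    have h1 : E.rp i (t + 1) = (CRR.replicaStep i inp (E.rp i t)).state :=
      (E.replica_of_replicaInput_eq_some h).1
    generalize he : E.act t = e at h
    rcases e with _ | ⟨c', op⟩ | ⟨src, i | c', m⟩ | (i | c') | p | i | ⟨i, s⟩ <;>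
      simp only [Event.replicaInput, Option.ite_none_right_eq_some, Option.some.injEq,
        reduceCtorEq] at h <;>
      obtain ⟨rfl, rfl⟩ := h
    · cases m with
      | read id req =>
        refine .same (h1.trans ?_)
        cases hst : (E.rp i t).stale <;> simp [CRR.replicaStep, hst]
      | write id ts v => exact .adopt src id ts v he h1
      | _ => exact .same h1
    · exact .same h1

theorem stale_eq_false_of_P (hP : P n k r b) (i : Fin n) (t : ℕ) : (E.rp i t).stale = false := by
  induction t using Nat.strong_induction_on with
  | _ t ih =>
    cases t with
    | zero => rw [rp_zero]; rfl
    | succ t =>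
      obtain h | ⟨src, id, ts, v, -, h⟩ | ⟨-, -, h⟩ | ⟨s, -, hs, -, h⟩ := E.replicaMove i t
      · rw [h, ih t (by omega)]
      · rw [h]; split_ifs <;> exact ih t (by omega)
      · rw [h, if_pos hP]; rfl
      · rw [h, ih s (by omega)]

theorem stale_eq_false_of_up {i : Fin n} (hi : ∀ t, E.Up (.rep i) t) (t : ℕ) :
    (E.rp i t).stale = false := by
  induction t using Nat.strong_induction_on with
  | _ t ih =>
    cases t with
    | zero => rw [rp_zero]; rfl
    | succ t =>
      obtain h | ⟨src, id, ts, v, -, h⟩ | ⟨hu, -, -⟩ | ⟨s, -, hs, -, h⟩ := E.replicaMove i t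
      · rw [h, ih t (by omega)]
      · rw [h]; split_ifs <;> exact ih t (by omega)
      · exact absurd (hi t) hu
      · rw [h, ih s (by omega)]

/-- The timestamp of a replica that keeps it in storage and never rolls back is monotone; if `P` fails,
so is that of every replica as long as it is not stale, since it has not restarted then. -/
theorem ts_mono {i : Fin n} (hi : P n k r b → Persists k r b S i ∧ ¬ E.RollsBack i) {t t' : ℕ}
    (htt : t ≤ t') (hs : (E.rp i t').stale = false) : (E.rp i t).ts ≤ (E.rp i t').ts := by
  induction t', htt using Nat.le_induction with
  | base => exact le_rfl
  | succ t' _ ih =>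
    obtain h | ⟨src, id, ts, v, -, h⟩ | ⟨-, hp, h⟩ | ⟨s, he, -, hp, h⟩ := E.replicaMove i t'
    · rw [h] at hs ⊢
      exact ih hs
    · rw [h] at hs ⊢
      split_ifs at hs ⊢ with hlt
      · exact (ih hs).trans hlt.le
      · exact ih hs
    · by_cases hP : P n k r b
      · exact absurd (hi hP).1 hp
      · rw [h, if_neg hP] at hs
        simp at hs
    · exact absurd ⟨t', s, he⟩ (hi hp.1).2

theorem le_ts_of_act_write {i : Fin n} {t : ℕ} {src : Proc n} {id : ReqId} {ts : Timestamp} {v : V}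
    (he : E.act t = .deliver src (.rep i) (.write id ts v)) : ts ≤ (E.rp i (t + 1)).ts := by
  have h1 : E.rp i (t + 1) = if (E.rp i t).ts < ts then { E.rp i t with ts := ts, val := v }
      else E.rp i t := by
    have h : (E.act t).replicaInput i = some (.recv src (.write id ts v)) := by
      simp [he, Event.replicaInput]
    exact (E.replica_of_replicaInput_eq_some h).1
  rw [h1]
  split_ifs with h
  · exact le_rfl
  · exact not_lt.1 h

/-! ### The life of an operation -/

/-- The phase of client `c` at time `t`. -/
def ph (c t : ℕ) : Phase n V := (E.cl c t).phase

/-- The number of request identifiers that client `c` has used before time `t`. -/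
def nid (c t : ℕ) : ℕ := (E.cl c t).nextId

/-- Since a busy client cannot invoke an operation, every invocation finds the client idle. -/
theorem busy_iff (c t : ℕ) : (E.cfg t).busy c = true ↔ E.ph c t ≠ .idle := by
  unfold ph
  induction t with
  | zero => rw [cl_zero, E.init]; simp [Config.initial]
  | succ t ih =>
    obtain ⟨o, hm, -, hb⟩ := E.exists_clientMove c t
    rw [hb, ih]
    generalize E.cl c t = σ at hm
    generalize E.cl c (t + 1) = σ' at hm
    cases hm with
    | stay _ hw hr hra hwa hi =>
      refine ⟨?_, fun h => ⟨.inl h, rfl⟩⟩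
      rintro ⟨h | ⟨op, h⟩, -⟩
      · exact h
      · exact hi op h
    | invoke op m he => simp [he]
    | _ => simp

theorem ph_of_act_invoke {s c : ℕ} {op : Op V} (h : E.act s = .invoke c op) : E.ph c s = .idle := by
  have h1 := E.allowed s
  rw [show E.ev s = .invoke c op from h] at h1
  have h2 := E.busy_iff c s
  rw [h1.2] at h2
  simpa using h2

theorem cl_of_act_invoke {s c : ℕ} {op : Op V} (h : E.act s = .invoke c op) :
    E.cl c (s + 1) = ⟨E.nid c s + 1, .readQuorum op (c, E.nid c s) fun _ => none⟩ := by
  have h1 := E.ph_of_act_invoke h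
  obtain ⟨o, hm, -, -⟩ := E.exists_clientMove c s
  unfold ph at h1
  unfold nid
  generalize E.cl c s = σ at hm h1
  generalize E.cl c (s + 1) = σ' at hm
  rw [h] at hm
  cases hm with
  | stay _ hw hr hra hwa hi => exact absurd h1 (hi op rfl)
  | invoke op m he => cases he; rfl
  | _ => simp_all

theorem nid_mono (c : ℕ) : Monotone (E.nid c) := by
  refine monotone_nat_of_le_succ fun t => ?_
  obtain ⟨o, hm, -, -⟩ := E.exists_clientMove c t
  unfold nid
  generalize E.cl c t = σ at hm
  generalize E.cl c (t + 1) = σ' at hm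
  cases hm <;> simp

/-- The operation `op`, invoked by client `c` at time `s`, is in `read_quorum` at time `t`, and `acks`
are the answers received so far. -/
structure Reading (s c : ℕ) (op : Op V) (t : ℕ) (acks : Fin n → Option (ReadVal V)) : Prop where
  act : E.act s = .invoke c op
  lt : s < t
  ph : E.ph c t = .readQuorum op (c, E.nid c s) acks
  ph' : ∀ t', s < t' → t' ≤ t → ∃ acks', E.ph c t' = .readQuorum op (c, E.nid c s) acks'
  ack : ∀ j x, acks j = some x → ∃ src t', s < t' ∧ t' < t ∧
    E.act t' = .deliver src (.cli c) (.readAck (c, E.nid c s) x j)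

/-- The operation `op`, invoked by client `c` at time `s`, leaves `read_quorum` at time `e`, having
chosen the timestamp `ts`, the value `v` and the response `y`. -/
def Chooses (s c : ℕ) (op : Op V) (e : ℕ) (ts : Timestamp) (v : V) (y : Resp V) : Prop :=
  ∃ acks, E.Reading s c op e acks ∧ E.act e = .tick (.cli c) ∧
    readQuorumSize n k r b ≤ (Finset.univ.filter fun j => (acks j).isSome).card ∧
    choose v₀ c acks op = (ts, v, y)

/-- Client `c`, which called `write_quorum` at time `e` with timestamp `ts` and value `v`, is still
there at time `t`; `acks` are the replicas whose acknowledgement was received, and `y` the response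
that it will return. -/
structure Writing (e c : ℕ) (ts : Timestamp) (v : V) (y : Resp V) (t : ℕ) (acks : Finset (Fin n)) :
    Prop where
  lt : e < t
  ph : E.ph c t = .writeQuorum (c, E.nid c e) ts v acks y
  ph' : ∀ t', e < t' → t' ≤ t → ∃ acks', E.ph c t' = .writeQuorum (c, E.nid c e) ts v acks' y
  ack : ∀ j ∈ acks, ∃ src t', e < t' ∧ t' < t ∧
    E.act t' = .deliver src (.cli c) (.writeAck (c, E.nid c e) j)

theorem exists_reading {c t : ℕ} {op : Op V} {id : ReqId} {acks : Fin n → Option (ReadVal V)}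
    (h : E.ph c t = .readQuorum op id acks) :
    ∃ s, id = (c, E.nid c s) ∧ E.Reading s c op t acks := by
  induction t generalizing acks with
  | zero => simp [ph, cl_zero] at h
  | succ t ih =>
    have ext : ∀ {s acks'}, E.Reading s c op t acks' → ∀ t', s < t' → t' ≤ t + 1 → id = (c, E.nid c s) →
        ∃ acks', E.ph c t' = .readQuorum op (c, E.nid c s) acks' := by
      intro s acks' hR t' h1 h2 h3
      obtain rfl | h2 := Nat.le_add_one_iff.1 h2 |>.symm
      · exact ⟨_, h3 ▸ h⟩
      · exact hR.ph' t' h1 h2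
    obtain ⟨o, hm, -, -⟩ := E.exists_clientMove c t
    generalize hσ : E.cl c t = σ at hm
    generalize hσ' : E.cl c (t + 1) = σ' at hm
    have h' : σ'.phase = .readQuorum op id acks := by rw [← hσ']; exact h
    cases hm with
    | stay _ hw hr hra hwa hi =>
      obtain ⟨s, hid, hR⟩ := ih (acks := acks) (by rw [ph, hσ]; exact h')
      refine ⟨s, hid, hR.act, by have := hR.lt; omega, hid ▸ h,
        fun t' h1 h2 => ext hR t' h1 h2 hid, fun j x hj => ?_⟩
      obtain ⟨src, t', h1, h2, h3⟩ := hR.ack j x hj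
      exact ⟨src, t', h1, by omega, h3⟩
    | invoke op' m he =>
      simp only [Phase.readQuorum.injEq] at h'
      obtain ⟨rfl, rfl, rfl⟩ := h'
      have hn : E.nid c t = m := by simp [nid, hσ]
      rw [← hn] at h ⊢
      refine ⟨t, rfl, he, by omega, h, fun t' h1 h2 => ?_, by simp⟩
      obtain rfl : t' = t + 1 := by omega
      exact ⟨_, h⟩
    | readAck src m op' id' x j acks' he hj =>
      simp only [Phase.readQuorum.injEq] at h'
      obtain ⟨rfl, rfl, rfl⟩ := h'
      obtain ⟨s, hid, hR⟩ := ih (acks := acks') (by rw [ph, hσ])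
      refine ⟨s, hid, hR.act, by have := hR.lt; omega, hid ▸ h,
        fun t' h1 h2 => ext hR t' h1 h2 hid, fun j' x' hj' => ?_⟩
      by_cases hjj : j' = j
      · subst hjj
        simp only [Function.update_self, Option.some.injEq] at hj'
        subst hj'
        exact ⟨src, t, hR.lt, by omega, hid ▸ he⟩
      · rw [Function.update_of_ne hjj] at hj'
        obtain ⟨src, t', h1, h2, h3⟩ := hR.ack j' x' hj'
        exact ⟨src, t', h1, by omega, h3⟩
    | _ => simp at h'

theorem exists_writing {c t : ℕ} {id : ReqId} {ts : Timestamp} {v : V} {acks : Finset (Fin n)}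
    {y : Resp V} (h : E.ph c t = .writeQuorum id ts v acks y) :
    ∃ s op e, id = (c, E.nid c e) ∧ E.Chooses s c op e ts v y ∧ E.Writing e c ts v y t acks := by
  induction t generalizing acks with
  | zero => simp [ph, cl_zero] at h
  | succ t ih =>
    have ext : ∀ {e acks'}, E.Writing e c ts v y t acks' → ∀ t', e < t' → t' ≤ t + 1 →
        id = (c, E.nid c e) → ∃ acks', E.ph c t' = .writeQuorum (c, E.nid c e) ts v acks' y := by
      intro e acks' hR t' h1 h2 h3
      obtain rfl | h2 := Nat.le_add_one_iff.1 h2 |>.symm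
      · exact ⟨_, h3 ▸ h⟩
      · exact hR.ph' t' h1 h2
    obtain ⟨o, hm, -, -⟩ := E.exists_clientMove c t
    generalize hσ : E.cl c t = σ at hm
    generalize hσ' : E.cl c (t + 1) = σ' at hm
    have h' : σ'.phase = .writeQuorum id ts v acks y := by rw [← hσ']; exact h
    cases hm with
    | stay _ hw hr hra hwa hi =>
      obtain ⟨s, op, e, hid, hC, hW⟩ := ih (acks := acks) (by rw [ph, hσ]; exact h')
      refine ⟨s, op, e, hid, hC, by have := hW.lt; omega, hid ▸ h,
        fun t' h1 h2 => ext hW t' h1 h2 hid, fun j hj => ?_⟩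
      obtain ⟨src, t', h1, h2, h3⟩ := hW.ack j hj
      exact ⟨src, t', h1, by omega, h3⟩
    | switch m op id' acks' t' v' y' he hq hc =>
      simp only [Phase.writeQuorum.injEq] at h'
      obtain ⟨rfl, rfl, rfl, rfl, rfl⟩ := h'
      have hn : E.nid c t = m := by simp [nid, hσ]
      obtain ⟨s, -, hR⟩ := E.exists_reading (c := c) (t := t) (op := op) (id := id') (acks := acks')
        (by rw [ph, hσ])
      rw [← hn] at h ⊢
      refine ⟨s, op, t, rfl, ⟨acks', hR, he, hq, hc⟩, by omega, h, fun t' h1 h2 => ?_, by simp⟩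
      obtain rfl : t' = t + 1 := by omega
      exact ⟨_, h⟩
    | writeAck src m id' t' v' acks' y' j he =>
      simp only [Phase.writeQuorum.injEq] at h'
      obtain ⟨rfl, rfl, rfl, rfl, rfl⟩ := h'
      obtain ⟨s, op, e, hid, hC, hW⟩ := ih (acks := acks') (by rw [ph, hσ])
      refine ⟨s, op, e, hid, hC, by have := hW.lt; omega, hid ▸ h,
        fun t' h1 h2 => ext hW t' h1 h2 hid, fun j' hj' => ?_⟩
      obtain rfl | hj' := Finset.mem_insert.1 hj'
      · exact ⟨src, t, hW.lt, by omega, hid ▸ he⟩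
      · obtain ⟨src, t', h1, h2, h3⟩ := hW.ack j' hj'
        exact ⟨src, t', h1, by omega, h3⟩
    | _ => simp at h'

variable {E}

theorem Chooses.cl {s c e : ℕ} {op : Op V} {ts : Timestamp} {v : V} {y : Resp V}
    (h : E.Chooses s c op e ts v y) :
    E.cl c (e + 1) = ⟨E.nid c e + 1, .writeQuorum (c, E.nid c e) ts v ∅ y⟩ := by
  obtain ⟨acks, hR, he, hq, hc⟩ := h
  obtain ⟨o, hm, -, -⟩ := E.exists_clientMove c e
  have h1 := hR.ph
  unfold Execution.ph at h1
  unfold nid at h1 ⊢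
  generalize E.cl c e = σ at hm h1
  generalize E.cl c (e + 1) = σ' at hm
  cases hm with
  | stay _ hw hr hra hwa hi => exact absurd hq (not_le.2 (hr _ _ _ he h1))
  | switch m op' id' acks' t' v' y' he hq hc' =>
    simp only [Phase.readQuorum.injEq] at h1
    obtain ⟨rfl, rfl, rfl⟩ := h1
    rw [hc'] at hc
    simp only [Prod.mk.injEq] at hc
    obtain ⟨rfl, rfl, rfl⟩ := hc
    rfl
  | readAck => simp_all
  | _ => simp at h1

theorem Chooses.act {s c e : ℕ} {op : Op V} {ts : Timestamp} {v : V} {y : Resp V}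
    (h : E.Chooses s c op e ts v y) : E.act s = .invoke c op :=
  let ⟨_, hR, _⟩ := h
  hR.act

theorem Chooses.lt {s c e : ℕ} {op : Op V} {ts : Timestamp} {v : V} {y : Resp V}
    (h : E.Chooses s c op e ts v y) : s < e :=
  let ⟨_, hR, _⟩ := h
  hR.lt

/-- An operation leaves `read_quorum` only once. -/
theorem Chooses.eq {s c e c' e' : ℕ} {op op' : Op V} {ts ts' : Timestamp} {v v' : V} {y y' : Resp V}
    (h : E.Chooses s c op e ts v y) (h' : E.Chooses s c' op' e' ts' v' y') :
    c = c' ∧ op = op' ∧ e = e' ∧ ts = ts' ∧ v = v' ∧ y = y' := by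
  have h1 : (Event.invoke c op : Event n V (RegMsg n V)) = .invoke c' op' :=
    h.act.symm.trans h'.act
  simp only [Event.invoke.injEq] at h1
  obtain ⟨rfl, rfl⟩ := h1
  have aux : ∀ {e e' ts ts' v v' y y'}, E.Chooses s c op e ts v y → E.Chooses s c op e' ts' v' y' →
      e' ≤ e := by
    intro e e' ts ts' v v' y y' h h'
    by_contra hlt
    obtain ⟨acks, hR, -⟩ := h'
    obtain ⟨acks', h2⟩ := hR.ph' (e + 1) (by have := h.lt; omega) (by omega)
    simp [ph, h.cl] at h2
  have he : e = e' := le_antisymm (aux h' h) (aux h h')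
  subst he
  have h2 := h.cl.symm.trans h'.cl
  simp only [RegClient.mk.injEq, Phase.writeQuorum.injEq, true_and] at h2
  exact ⟨rfl, rfl, rfl, h2⟩

/-- Request identifiers of `read_quorum` are fresh. -/
theorem le_of_sends_read {s c t : ℕ} {op : Op V} (h : E.act s = .invoke c op) {src dst : Proc n}
    {req : ReadReq} (hs : E.Sends t src dst (.read (c, E.nid c s) req)) :
    s ≤ t ∧ req = requestOf op := by
  cases src with
  | rep i =>
    obtain ⟨_, _, _, _, h'⟩ | ⟨_, _, _, _, h'⟩ := E.sends_rep_iff.1 hs <;> simp at h'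
  | cli c' =>
    obtain ⟨-, -, ⟨op', id, acks, h1, h2⟩ | ⟨_, _, _, _, _, _, h2⟩⟩ := E.sends_cli_iff.1 hs
    swap
    · simp at h2
    simp only [RegMsg.read.injEq] at h2
    obtain ⟨rfl, rfl⟩ := h2
    obtain ⟨s', hid, hR⟩ := E.exists_reading h1
    simp only [Prod.mk.injEq] at hid
    obtain ⟨rfl, hid⟩ := hid
    have aux : ∀ {s s' op op'}, E.act s = .invoke c op → E.act s' = .invoke c op' →
        E.nid c s = E.nid c s' → s' ≤ s := by
      intro s s' op op' h h' hn
      by_contra hlt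
      have h1 := E.nid_mono c (show s + 1 ≤ s' by omega)
      have h2 : E.nid c (s + 1) = E.nid c s + 1 := by
        have := E.cl_of_act_invoke h
        simp [nid, this]
      omega
    have hss : s = s' := le_antisymm (aux hR.act h hid.symm) (aux h hR.act hid)
    subst hss
    refine ⟨by have := hR.lt; omega, ?_⟩
    have := h.symm.trans hR.act
    simp only [Event.invoke.injEq, true_and] at this
    rw [this]

/-- Request identifiers of `write_quorum` are fresh. -/
theorem le_of_sends_write {s c e t : ℕ} {op : Op V} {ts ts' : Timestamp} {v v' : V} {y : Resp V}
    (h : E.Chooses s c op e ts v y) {src dst : Proc n}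
    (hs : E.Sends t src dst (.write (c, E.nid c e) ts' v')) : e ≤ t ∧ ts' = ts := by
  cases src with
  | rep i =>
    obtain ⟨_, _, _, _, h'⟩ | ⟨_, _, _, _, h'⟩ := E.sends_rep_iff.1 hs <;> simp at h'
  | cli c' =>
    obtain ⟨-, -, ⟨_, _, _, _, h2⟩ | ⟨id, ts'', v'', acks, y', h1, h2⟩⟩ := E.sends_cli_iff.1 hs
    · simp at h2
    simp only [RegMsg.write.injEq] at h2
    obtain ⟨rfl, rfl, rfl⟩ := h2
    obtain ⟨s', op', e', hid, hC, hW⟩ := E.exists_writing h1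
    simp only [Prod.mk.injEq] at hid
    obtain ⟨rfl, hid⟩ := hid
    have aux : ∀ {s s' op op' e e' ts ts' v v' y y'}, E.Chooses s c op e ts v y →
        E.Chooses s' c op' e' ts' v' y' → E.nid c e = E.nid c e' → e' ≤ e := by
      intro s s' op op' e e' ts ts' v v' y y' h h' hn
      by_contra hlt
      have h1 := E.nid_mono c (show e + 1 ≤ e' by omega)
      have h2 : E.nid c (e + 1) = E.nid c e + 1 := by simp [nid, h.cl]
      omega
    have hee : e = e' := le_antisymm (aux hC h hid.symm) (aux h hC hid)
    subst hee
    refine ⟨by have := hW.lt; omega, ?_⟩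
    have h2 := h.cl.symm.trans hC.cl
    simp only [RegClient.mk.injEq, Phase.writeQuorum.injEq, true_and] at h2
    exact h2.1.symm

theorem act_of_sends_readAck {t : ℕ} {src dst : Proc n} {id : ReqId} {x : ReadVal V} {j : Fin n}
    (hs : E.Sends t src dst (.readAck id x j)) :
    ∃ req, E.act t = .deliver dst (.rep j) (.read id req) ∧ (E.rp j t).stale = false ∧
      x = req.answer (E.rp j t) := by
  cases src with
  | rep i =>
    obtain ⟨id', req, h1, h2, h3⟩ | ⟨_, _, _, _, h'⟩ := E.sends_rep_iff.1 hs
    · simp only [RegMsg.readAck.injEq] at h3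
      obtain ⟨rfl, rfl, rfl⟩ := h3
      exact ⟨req, h1, h2, rfl⟩
    · simp at h'
  | cli c' =>
    obtain ⟨-, -, ⟨_, _, _, _, h2⟩ | ⟨_, _, _, _, _, _, h2⟩⟩ := E.sends_cli_iff.1 hs <;> simp at h2

theorem act_of_sends_writeAck {t : ℕ} {src dst : Proc n} {id : ReqId} {j : Fin n}
    (hs : E.Sends t src dst (.writeAck id j)) :
    ∃ ts v, E.act t = .deliver dst (.rep j) (.write id ts v) := by
  cases src with
  | rep i =>
    obtain ⟨_, _, _, _, h'⟩ | ⟨id', ts, v, h1, h2⟩ := E.sends_rep_iff.1 hs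
    · simp at h'
    · simp only [RegMsg.writeAck.injEq] at h2
      obtain ⟨rfl, rfl⟩ := h2
      exact ⟨ts, v, h1⟩
  | cli c' =>
    obtain ⟨-, -, ⟨_, _, _, _, h2⟩ | ⟨_, _, _, _, _, _, h2⟩⟩ := E.sends_cli_iff.1 hs <;> simp at h2

/-- An answer recorded in `read_quorum` was given, since the invocation, by a replica that was not
stale. -/
theorem Reading.exists_answer {s c t : ℕ} {op : Op V} {acks : Fin n → Option (ReadVal V)}
    (h : E.Reading s c op t acks) {j : Fin n} {x : ReadVal V} (hj : acks j = some x) :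
    ∃ a, s < a ∧ a < t ∧ (E.rp j a).stale = false ∧ x = (requestOf op).answer (E.rp j a) := by
  obtain ⟨src, t3, -, h3, h3'⟩ := h.ack j x hj
  obtain ⟨t2, h2, h2'⟩ := E.exists_sends_of_act_deliver h3'
  obtain ⟨req, h4, h5, rfl⟩ := act_of_sends_readAck h2'
  obtain ⟨t1, h1, h1'⟩ := E.exists_sends_of_act_deliver h4
  obtain ⟨h6, rfl⟩ := le_of_sends_read h.act h1'
  exact ⟨t2, by omega, by omega, h5, rfl⟩

/-- A replica whose acknowledgement was received in `write_quorum` has reached the timestamp. -/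
theorem Writing.exists_le_ts {s c e t : ℕ} {op : Op V} {ts : Timestamp} {v : V} {y : Resp V}
    {acks : Finset (Fin n)} (hC : E.Chooses s c op e ts v y) (h : E.Writing e c ts v y t acks)
    {j : Fin n} (hj : j ∈ acks) : ∃ a ≤ t, ts ≤ (E.rp j a).ts := by
  obtain ⟨src, t3, -, h3, h3'⟩ := h.ack j hj
  obtain ⟨t2, h2, h2'⟩ := E.exists_sends_of_act_deliver h3'
  obtain ⟨ts', v', h4⟩ := act_of_sends_writeAck h2'
  obtain ⟨t1, h1, h1'⟩ := E.exists_sends_of_act_deliver h4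
  obtain ⟨h6, rfl⟩ := le_of_sends_write hC h1'
  exact ⟨t2 + 1, by omega, E.le_ts_of_act_write h4⟩

/-! ### Responses -/

theorem responds_iff {t c : ℕ} {y : Resp V} : E.Responds t c y ↔ E.act t = .tick (.cli c) ∧
    ∃ id ts v acks, E.ph c t = .writeQuorum id ts v acks y ∧ n - k ≤ acks.card := by
  obtain ⟨o, hm, ho, -⟩ := E.exists_clientMove c t
  rw [ho]
  unfold ph
  generalize E.cl c t = σ at hm
  generalize E.cl c (t + 1) = σ' at hm
  cases hm with
  | stay _ hw hr hra hwa hi =>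
    simp only [reduceCtorEq, false_iff, not_and, not_exists, not_le]
    exact fun he id ts v acks h => hw _ _ _ _ _ he h
  | finish m id t v acks y' he hq =>
    simp only [Option.some.injEq, he, true_and, Phase.writeQuorum.injEq]
    constructor
    · rintro rfl
      exact ⟨_, _, _, _, ⟨rfl, rfl, rfl, rfl, rfl⟩, hq⟩
    · rintro ⟨_, _, _, _, ⟨-, -, -, -, h⟩, -⟩
      exact h
  | writeAck src m id t v acks y j he => simp [he]
  | _ => simp

theorem ph_of_responds {t c : ℕ} {y : Resp V} (h : E.Responds t c y) : E.ph c (t + 1) = .idle := by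
  obtain ⟨o, hm, ho, -⟩ := E.exists_clientMove c t
  rw [ho] at h
  unfold ph
  generalize E.cl c t = σ at hm
  generalize E.cl c (t + 1) = σ' at hm
  cases hm <;> simp_all

/-- A client that is executing an operation stays so until it returns a response. -/
theorem ph_ne_idle_of_forall_not_responds {s c t : ℕ} (hs : E.ph c s ≠ .idle) (hst : s ≤ t)
    (h : ∀ t', s ≤ t' → t' < t → ∀ y, ¬ E.Responds t' c y) : E.ph c t ≠ .idle := by
  induction t, hst using Nat.le_induction with
  | base => exact hs
  | succ t hst ih =>
    have h1 := ih fun t' h1 h2 => h t' h1 (by omega)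
    have h2 := h t hst (by omega)
    obtain ⟨o, hm, ho, -⟩ := E.exists_clientMove c t
    simp only [ho] at h2
    unfold ph at h1 ⊢
    generalize E.cl c t = σ at hm h1
    generalize E.cl c (t + 1) = σ' at hm
    cases hm <;> simp_all

theorem ph_ne_idle_of_act_invoke {s c t : ℕ} {op : Op V} (hs : E.act s = .invoke c op) (hst : s < t)
    (h : ∀ t', s ≤ t' → t' < t → ∀ y, ¬ E.Responds t' c y) : E.ph c t ≠ .idle := by
  refine ph_ne_idle_of_forall_not_responds (s := s + 1) ?_ hst fun t' h1 h2 => h t' (by omega) h2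
  have := E.cl_of_act_invoke hs
  simp [ph, this]

theorem not_responds_of_act_invoke {s c : ℕ} {op : Op V} (hs : E.act s = .invoke c op) (y : Resp V) :
    ¬ E.Responds s c y := by
  rw [responds_iff, hs]
  simp

theorem exists_returns_of_responds {s t c : ℕ} {op : Op V} {y : Resp V}
    (hs : E.act s = .invoke c op) (hst : s ≤ t) (h : E.Responds t c y) :
    ∃ t' ≤ t, ∃ y', E.Returns s t' y' := by
  classical
  have hex : ∃ t', s ≤ t' ∧ ∃ y, E.Responds t' c y := ⟨t, hst, y, h⟩
  obtain ⟨h1, y', h2⟩ := Nat.find_spec hex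
  refine ⟨Nat.find hex, Nat.find_min' hex ⟨hst, y, h⟩, y', c, op, hs, h1, h2, ?_⟩
  exact fun t' h3 h4 y' h5 => Nat.find_min hex h4 ⟨h3, y', h5⟩

/-- A client invokes an operation only when its previous one has returned. -/
theorem exists_returns_of_act_invoke {s s' c : ℕ} {op op' : Op V} (hs : E.act s = .invoke c op)
    (hs' : E.act s' = .invoke c op') (hlt : s < s') : ∃ t < s', ∃ y, E.Returns s t y := by
  by_contra hno
  refine ph_ne_idle_of_act_invoke hs hlt (fun t h1 h2 y h3 => hno ?_) (E.ph_of_act_invoke hs')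
  obtain ⟨t', h4, y', h5⟩ := exists_returns_of_responds hs h1 h3
  exact ⟨t', by omega, y', h5⟩

/-- Every response is that of an operation, which has chosen it together with a timestamp and a value,
and then stored these at `n - k` replicas. -/
theorem exists_returns_of_responds' {t c : ℕ} {y : Resp V} (h : E.Responds t c y) :
    ∃ s op e ts v acks, E.Returns s t y ∧ E.Chooses s c op e ts v y ∧ E.Writing e c ts v y t acks ∧
      n - k ≤ acks.card := by
  obtain ⟨-, id, ts, v, acks, h1, h2⟩ := responds_iff.1 h
  obtain ⟨s, op, e, -, hC, hW⟩ := E.exists_writing h1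
  refine ⟨s, op, e, ts, v, acks, ?_, hC, hW, h2⟩
  have hlt := hW.lt
  have hlt' := hC.lt
  refine ⟨c, op, hC.act, by omega, h, fun t' h3 h4 y' h5 => ?_⟩
  obtain rfl | h3 := h3.eq_or_lt
  · exact not_responds_of_act_invoke hC.act _ h5
  by_cases he : t' ≤ e
  · obtain ⟨acks', hR, -⟩ := hC
    obtain ⟨acks'', h6⟩ := hR.ph' t' h3 he
    obtain ⟨-, _, _, _, _, h7, -⟩ := responds_iff.1 h5
    simp [h6] at h7
  · obtain ⟨acks', h6⟩ := hW.ph' (t' + 1) (by omega) (by omega)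
    simp [ph_of_responds h5] at h6

/-- A response belongs to one operation only, because the operations of a client do not overlap. -/
theorem Returns.unique {s s' t : ℕ} {y y' : Resp V} (h : E.Returns s t y) (h' : E.Returns s' t y') :
    s = s' := by
  have aux : ∀ {s s' y y'}, E.Returns s t y → E.Returns s' t y' → s' ≤ s := by
    intro s s' y y' h h'
    by_contra hlt
    obtain ⟨c, op, h1, h2, h3, h4⟩ := h
    obtain ⟨c', op', h1', h2', h3', -⟩ := h'
    have hcc : c = c' := by
      have := Eq.trans (Eq.symm h3) h3'
      simp only [Option.some.injEq, Prod.mk.injEq] at this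
      exact this.1
    subst hcc
    exact ph_ne_idle_of_act_invoke h1 (not_le.1 hlt) (fun t' h5 h6 => h4 t' h5 (by omega))
      (E.ph_of_act_invoke h1')
  exact le_antisymm (aux h' h) (aux h h')

theorem Returns.exists_chooses {s t : ℕ} {y : Resp V} (h : E.Returns s t y) :
    ∃ c op e ts v acks, E.Chooses s c op e ts v y ∧ E.Writing e c ts v y t acks ∧
      n - k ≤ acks.card := by
  obtain ⟨c, op, h1, h2, h3, h4⟩ := id h
  obtain ⟨s', op', e, ts, v, acks, h5, h6, h7, h8⟩ := exists_returns_of_responds' h3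
  obtain rfl := h.unique h5
  exact ⟨c, op', e, ts, v, acks, h6, h7, h8⟩

end Execution

/-! ### The choice of a timestamp -/

theorem mem_answers {acks : Fin n → Option (ReadVal V)} {x : ReadVal V} :
    x ∈ answers acks ↔ ∃ j, acks j = some x := by
  simp [answers]

/-- A write chooses a timestamp that is larger than all answers and carries the name of its client. -/
theorem choose_write {c : ℕ} {acks : Fin n → Option (ReadVal V)} {w v : V} {ts : Timestamp}
    {y : Resp V} (h : choose v₀ c acks (.write w) = (ts, v, y)) :
    v = w ∧ y = .ack ∧ toLex (0, 0) < ts ∧ (ofLex ts).2 = n + 1 + c ∧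
      ∀ j x, acks j = some x → x.timestamp < ts := by
  simp only [choose, Prod.mk.injEq] at h
  obtain ⟨rfl, rfl, rfl⟩ := h
  refine ⟨rfl, rfl, ?_, rfl, fun j x hj => ?_⟩
  · rw [Prod.Lex.toLex_lt_toLex]
    simp
  · have hmem : (ofLex x.timestamp).1 ∈ (answers acks).map fun x => (ofLex x.timestamp).1 :=
      List.mem_map.2 ⟨x, mem_answers.2 ⟨j, hj⟩, rfl⟩
    have hle := List.le_max_of_le hmem le_rfl
    rw [Prod.Lex.lt_iff]
    exact .inl (Nat.lt_succ_of_le hle)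

/-- A read chooses one of the answers, with the largest timestamp.  That the quorum is nonempty and all
answers carry a value excludes the default in `choose`. -/
theorem choose_read {c : ℕ} {acks : Fin n → Option (ReadVal V)} {v : V} {ts : Timestamp}
    {y : Resp V} (h : choose v₀ c acks .read = (ts, v, y))
    (hacks : ∀ j x, acks j = some x → ∃ ts' v', x = .tsVal ts' v') (hne : ∃ j x, acks j = some x) :
    y = .value v ∧ (∃ j, acks j = some (.tsVal ts v)) ∧
      ∀ j x, acks j = some x → x.timestamp ≤ ts := by
  have hmem : ∀ p : Timestamp × V, p ∈ (answers acks).filterMap ReadVal.pair? ↔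
      ∃ j, acks j = some (.tsVal p.1 p.2) := by
    intro p
    simp only [List.mem_filterMap, mem_answers]
    constructor
    · rintro ⟨x, ⟨j, hj⟩, hx⟩
      obtain ⟨ts', v', rfl⟩ := hacks j x hj
      simp only [ReadVal.pair?, Option.some.injEq] at hx
      subst hx
      exact ⟨j, hj⟩
    · rintro ⟨j, hj⟩
      exact ⟨_, ⟨j, hj⟩, rfl⟩
  obtain ⟨j, x, hj⟩ := hne
  obtain ⟨ts', v', rfl⟩ := hacks j x hj
  cases hmax : ((answers acks).filterMap ReadVal.pair?).argmax Prod.fst with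
  | none =>
    rw [List.argmax_eq_none] at hmax
    have := (hmem (ts', v')).2 ⟨j, hj⟩
    simp [hmax] at this
  | some p =>
    simp only [choose, hmax, Option.getD_some, Prod.mk.injEq] at h
    obtain ⟨rfl, rfl, rfl⟩ := h
    refine ⟨rfl, (hmem p).1 (List.argmax_mem hmax), fun j x hj => ?_⟩
    obtain ⟨ts', v', rfl⟩ := hacks j x hj
    exact List.le_of_mem_argmax ((hmem (ts', v')).2 ⟨j, hj⟩) hmax

namespace Execution

variable {E : Execution (algorithmKnown v₀ k r b S)}

/-- The chosen timestamp bounds, at some time since the invocation, that of every replica in a read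
quorum, strictly for a write. -/
theorem Chooses.exists_quorum {s c e : ℕ} {op : Op V} {ts : Timestamp} {v : V} {y : Resp V}
    (h : E.Chooses s c op e ts v y) :
    ∃ Q : Finset (Fin n), readQuorumSize n k r b ≤ Q.card ∧ ∀ j ∈ Q, ∃ a, s < a ∧
      (E.rp j a).stale = false ∧ (E.rp j a).ts ≤ ts ∧ (∀ w, op = .write w → (E.rp j a).ts < ts) := by
  obtain ⟨acks, hR, -, hq, hc⟩ := h
  have hts : ∀ req : ReadReq, ∀ σ : RegReplica V, (req.answer σ).timestamp = σ.ts := by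
    rintro (_ | _) σ <;> rfl
  refine ⟨_, hq, fun j hj => ?_⟩
  obtain ⟨x, hx⟩ := Option.isSome_iff_exists.1 (Finset.mem_filter.1 hj).2
  obtain ⟨a, h1, -, h3, rfl⟩ := hR.exists_answer hx
  refine ⟨a, h1, h3, ?_⟩
  rw [← hts (requestOf op)]
  cases op with
  | write w =>
    have := (choose_write hc).2.2.2.2 j _ hx
    exact ⟨this.le, fun _ _ => this⟩
  | read =>
    refine ⟨(choose_read hc (fun j' x' hj' => ?_) ⟨j, _, hx⟩).2.2 j _ hx, by simp⟩
    obtain ⟨a', -, -, -, rfl⟩ := hR.exists_answer hj'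
    exact ⟨_, _, rfl⟩

/-- A read chooses the timestamp and value that some replica had. -/
theorem Chooses.exists_eq_of_read {s c e : ℕ} {ts : Timestamp} {v : V} {y : Resp V}
    (hqr : 0 < readQuorumSize n k r b) (h : E.Chooses s c .read e ts v y) :
    y = .value v ∧ ∃ j, ∃ a < e, (E.rp j a).ts = ts ∧ (E.rp j a).val = v := by
  obtain ⟨acks, hR, -, hq, hc⟩ := h
  obtain ⟨j, hj⟩ := Finset.card_pos.1 (hqr.trans_le hq)
  obtain ⟨x, hx⟩ := Option.isSome_iff_exists.1 (Finset.mem_filter.1 hj).2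
  obtain ⟨h1, ⟨j', hj'⟩, -⟩ := choose_read hc (fun j' x' hj' => by
    obtain ⟨a', -, -, -, rfl⟩ := hR.exists_answer hj'
    exact ⟨_, _, rfl⟩) ⟨j, x, hx⟩
  obtain ⟨a, -, h2, -, h3⟩ := hR.exists_answer hj'
  simp only [requestOf, ReadReq.answer, ReadVal.tsVal.injEq] at h3
  exact ⟨h1, j', a, h2, h3.1.symm, h3.2.symm⟩

theorem Chooses.of_write {s c e : ℕ} {ts : Timestamp} {w v : V} {y : Resp V}
    (h : E.Chooses s c (.write w) e ts v y) :
    v = w ∧ y = .ack ∧ toLex (0, 0) < ts ∧ (ofLex ts).2 = n + 1 + c := by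
  obtain ⟨acks, -, -, -, hc⟩ := h
  obtain ⟨h1, h2, h3, h4, -⟩ := choose_write hc
  exact ⟨h1, h2, h3, h4⟩

/-! ### Provenance of timestamp-value pairs -/

variable (E) in
/-- The pair `(ts, v)` is the initial one, or a write of `v` has chosen `ts` before time `t`. -/
def Legit (t : ℕ) (ts : Timestamp) (v : V) : Prop :=
  (ts = toLex (0, 0) ∧ v = v₀) ∨ ∃ s c e v' y, e < t ∧ E.Chooses s c (.write v) e ts v' y

theorem Legit.mono {t t' : ℕ} {ts : Timestamp} {v : V} (h : E.Legit t ts v) (ht : t ≤ t') :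
    E.Legit t' ts v := by
  obtain h | ⟨s, c, e, v', y, h1, h2⟩ := h
  · exact .inl h
  · exact .inr ⟨s, c, e, v', y, by omega, h2⟩

/-- Every pair stored by a replica was chosen by a write, or is the initial one. -/
theorem legit_rp (hqr : 0 < readQuorumSize n k r b) (i : Fin n) (t : ℕ) :
    E.Legit t (E.rp i t).ts (E.rp i t).val := by
  induction t using Nat.strong_induction_on generalizing i with
  | _ t ih =>
    cases t with
    | zero => rw [rp_zero]; exact .inl ⟨rfl, rfl⟩
    | succ t =>
      obtain h | ⟨src, id, ts, v, he, h⟩ | ⟨-, -, h⟩ | ⟨s, -, hs, -, h⟩ := E.replicaMove i t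
      · rw [h]; exact (ih t (by omega) i).mono (by omega)
      · rw [h]
        split_ifs
        swap
        · exact (ih t (by omega) i).mono (by omega)
        obtain ⟨t', h1, h2⟩ := E.exists_sends_of_act_deliver he
        cases src with
        | rep i =>
          obtain ⟨_, _, _, _, h'⟩ | ⟨_, _, _, _, h'⟩ := E.sends_rep_iff.1 h2 <;> simp at h'
        | cli c =>
          obtain ⟨-, -, ⟨_, _, _, _, h3⟩ | ⟨id', ts', v', acks, y, h3, h4⟩⟩ := E.sends_cli_iff.1 h2
          · simp at h3
          simp only [RegMsg.write.injEq] at h4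
          obtain ⟨rfl, rfl, rfl⟩ := h4
          obtain ⟨s, op, e, -, hC, hW⟩ := E.exists_writing h3
          have hlt := hW.lt
          cases op with
          | write w =>
            obtain ⟨rfl, -⟩ := hC.of_write
            exact .inr ⟨s, c, e, _, y, by omega, hC⟩
          | read =>
            obtain ⟨-, j, a, ha, rfl, rfl⟩ := hC.exists_eq_of_read hqr
            exact (ih a (by omega) j).mono (by omega)
      · rw [h]
        split_ifs <;> exact .inl ⟨rfl, rfl⟩
      · rw [h]; exact (ih s (by omega) i).mono (by omega)

/-! ### Real-time order -/

variable (E) in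
/-- Each write quorum meets each read quorum in a replica whose timestamp never decreases while it
answers `READ` requests. -/
def QuorumsMeet : Prop :=
  ∀ Qw Qr : Finset (Fin n), n - k ≤ Qw.card → readQuorumSize n k r b ≤ Qr.card →
    ∃ j ∈ Qw, j ∈ Qr ∧ (P n k r b → Persists k r b S j ∧ ¬ E.RollsBack j)

/-- An operation that starts after another one has returned chooses no smaller timestamp, and a larger
one if it is a write. -/
theorem Chooses.le_of_returns (hQ : E.QuorumsMeet)
    {s c e t s' c' e' : ℕ} {op op' : Op V} {ts ts' : Timestamp} {v v' : V} {y y' y'' : Resp V}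
    (hC : E.Chooses s c op e ts v y) (hret : E.Returns s t y'') (hlt : t < s')
    (hC' : E.Chooses s' c' op' e' ts' v' y') :
    ts ≤ ts' ∧ ∀ w, op' = .write w → ts < ts' := by
  obtain ⟨c₁, op₁, e₁, ts₁, v₁, acks, hC₁, hW, hq⟩ := hret.exists_chooses
  obtain ⟨rfl, rfl, rfl, rfl, rfl, rfl⟩ := hC.eq hC₁
  obtain ⟨Q, hQ1, hQ2⟩ := hC'.exists_quorum
  obtain ⟨j, hj, hj', hg⟩ := hQ acks Q hq hQ1
  obtain ⟨a, ha, hts⟩ := hW.exists_le_ts hC hj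
  obtain ⟨a', ha', hst, hle, hlt'⟩ := hQ2 j hj'
  have hmono := hts.trans (E.ts_mono hg (show a ≤ a' by omega) hst)
  exact ⟨hmono.trans hle, fun w hw => hmono.trans_lt (hlt' w hw)⟩

/-- Distinct writes choose distinct timestamps. -/
theorem Chooses.eq_of_write (hQ : E.QuorumsMeet)
    {s c e s' c' e' : ℕ} {ts : Timestamp} {w w' v v' : V} {y y' : Resp V}
    (h : E.Chooses s c (.write w) e ts v y) (h' : E.Chooses s' c' (.write w') e' ts v' y') :
    s = s' := by
  have aux : ∀ {s c e s' c' e' : ℕ} {w w' v v' : V} {y y' : Resp V},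
      E.Chooses s c (.write w) e ts v y → E.Chooses s' c' (.write w') e' ts v' y' → s' ≤ s := by
    intro s c e s' c' e' w w' v v' y y' h h'
    by_contra hlt
    -- The client is encoded in the timestamp, and writes of one client follow one another.
    have hc : c = c' := by
      have := h.of_write.2.2.2.symm.trans h'.of_write.2.2.2
      omega
    subst hc
    obtain ⟨t, ht, y'', hret⟩ := exists_returns_of_act_invoke h.act h'.act (not_le.1 hlt)
    exact lt_irrefl _ ((h.le_of_returns hQ hret ht h').2 _ rfl)
  exact le_antisymm (aux h' h) (aux h h')

/-! ### Linearizability -/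

variable (E) in
/-- The timestamp that the operation invoked at time `s` chooses. -/
noncomputable def opTs (s : ℕ) : Timestamp :=
  open Classical in
  if h : ∃ ts, ∃ c op e v y, E.Chooses s c op e ts v y then h.choose else toLex (0, 0)

theorem Chooses.opTs_eq {s c e : ℕ} {op : Op V} {ts : Timestamp} {v : V} {y : Resp V}
    (h : E.Chooses s c op e ts v y) : E.opTs s = ts := by
  have hex : ∃ ts, ∃ c op e v y, E.Chooses s c op e ts v y := ⟨ts, c, op, e, v, y, h⟩
  obtain ⟨c', op', e', v', y', h'⟩ := hex.choose_spec
  rw [opTs, dif_pos hex]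
  exact (h'.eq h).2.2.2.1

variable (E) in
/-- The operations that take part in the linearization: the complete ones, and the writes whose
timestamp some complete operation has chosen. -/
def linearized : Set ℕ :=
  {s | (∃ c op e ts v y, E.Chooses s c op e ts v y) ∧
    (E.Complete s ∨ (∃ v, E.IsWrite s v) ∧ ∃ s', E.Complete s' ∧ E.opTs s' = E.opTs s)}

variable (E) in
/-- Operations are linearized by timestamp, each write before the reads with its timestamp, and these
by the time of their invocation. -/
noncomputable def key (s : ℕ) : Timestamp ×ₗ (Bool ×ₗ ℕ) :=
  open Classical in toLex (E.opTs s, toLex (decide (E.IsRead s), s))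

open Classical in
theorem key_lt_key {s s' : ℕ} : E.key s < E.key s' ↔ E.opTs s < E.opTs s' ∨
    E.opTs s = E.opTs s' ∧ (¬ E.IsRead s ∧ E.IsRead s' ∨
      (E.IsRead s ↔ E.IsRead s') ∧ s < s') := by
  simp only [key, Prod.Lex.toLex_lt_toLex, Bool.lt_iff, decide_eq_false_iff_not, decide_eq_true_iff,
    decide_eq_decide]

theorem key_injective : Function.Injective E.key := by
  intro s s' h
  simp only [key, EmbeddingLike.apply_eq_iff_eq, Prod.mk.injEq] at h
  exact h.2.2

theorem isRead_iff {s c : ℕ} {op : Op V} (h : E.act s = .invoke c op) : E.IsRead s ↔ op = .read := by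
  constructor
  · rintro ⟨c', h'⟩
    have : (Event.invoke c op : Event n V (RegMsg n V)) = .invoke c' .read := h.symm.trans h'
    simp only [Event.invoke.injEq] at this
    exact this.2
  · rintro rfl
    exact ⟨c, h⟩

theorem isWrite_iff {s c : ℕ} {op : Op V} {v : V} (h : E.act s = .invoke c op) :
    E.IsWrite s v ↔ op = .write v := by
  constructor
  · rintro ⟨c', h'⟩
    have : (Event.invoke c op : Event n V (RegMsg n V)) = .invoke c' (.write v) := h.symm.trans h'
    simp only [Event.invoke.injEq] at this
    exact this.2
  · rintro rfl
    exact ⟨c, h⟩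

/-- After a complete operation with the timestamp of `s` has returned, all operations that are invoked
come after `s`. -/
theorem finite_key_lt (hQ : E.QuorumsMeet) {s : ℕ}
    (hs : s ∈ E.linearized) : {s' ∈ E.linearized | E.key s' < E.key s}.Finite := by
  obtain ⟨⟨c, op, e, ts, v, y, hC⟩, hs⟩ := hs
  obtain ⟨s₀, ⟨t₀, y₀, hret⟩, hts⟩ : ∃ s', E.Complete s' ∧ E.opTs s' = E.opTs s := by
    obtain hs | ⟨-, hs⟩ := hs
    · exact ⟨s, hs, rfl⟩
    · exact hs
  refine (Set.finite_Iic (max t₀ s)).subset ?_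
  rintro s' ⟨⟨⟨c', op', e', ts', v', y', hC'⟩, -⟩, hlt⟩
  by_contra hmax
  simp only [Set.mem_Iic, le_max_iff, not_or, not_le] at hmax
  obtain ⟨c₁, op₁, e₁, ts₁, v₁, acks₁, hC₁, -⟩ := hret.exists_chooses
  obtain ⟨h1, h2⟩ := hC₁.le_of_returns hQ hret hmax.1 hC'
  rw [hC₁.opTs_eq, hC.opTs_eq] at hts
  subst hts
  rw [key_lt_key, hC.opTs_eq, hC'.opTs_eq, isRead_iff hC.act, isRead_iff hC'.act] at hlt
  obtain hlt | ⟨h3, ⟨h4, -⟩ | ⟨-, h4⟩⟩ := hlt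
  · exact absurd hlt (not_lt.2 h1)
  · cases op' with
    | read => exact h4 rfl
    | write w => exact absurd h3 (h2 w rfl).ne'
  · omega

end Execution

/-- A set of natural numbers that is linearly ordered so that each element has finitely many
predecessors can be arranged in a sequence. -/
theorem exists_pos_of_finite {α : Type*} [LinearOrder α] {L : Set ℕ} {f : ℕ → α}
    (hfin : ∀ s ∈ L, {s' ∈ L | f s' < f s}.Finite) :
    ∃ pos : ℕ → ℕ, ∀ s ∈ L, ∀ s' ∈ L, pos s < pos s' ↔ f s < f s' := by
  -- The position is the number of predecessors.
  refine ⟨fun s => {s' ∈ L | f s' < f s}.ncard, fun s hs s' hs' => ⟨fun h => ?_, fun h => ?_⟩⟩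
  · by_contra hle
    refine absurd h (not_lt.2 (Set.ncard_le_ncard ?_ (hfin s hs)))
    exact fun x hx => ⟨hx.1, hx.2.trans_le (not_lt.1 hle)⟩
  · refine Set.ncard_lt_ncard ⟨fun x hx => ⟨hx.1, hx.2.trans h⟩, fun hsub => ?_⟩ (hfin s' hs')
    exact lt_irrefl _ (hsub ⟨hs, h⟩).2

namespace Execution

variable {E : Execution (algorithmKnown v₀ k r b S)}

/-- The last write before a read in the linearization is the one that chose its timestamp. -/
theorem readsValue {L : Set ℕ} {pos : ℕ → ℕ} (hqr : 0 < readQuorumSize n k r b)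
    (hQ : E.QuorumsMeet) (hL : L = E.linearized)
    (hpos : ∀ s ∈ L, ∀ s' ∈ L, pos s < pos s' ↔ E.key s < E.key s')
    {s c e : ℕ} {ts : Timestamp} {v : V} {y : Resp V} (hC : E.Chooses s c .read e ts v y)
    (hs : E.Complete s) : E.ReadsValue v₀ L pos s v := by
  subst hL
  have hsL : s ∈ E.linearized := ⟨⟨_, _, _, _, _, _, hC⟩, .inl hs⟩
  have hread : E.IsRead s := (isRead_iff hC.act).2 rfl
  have before : ∀ w ∈ E.linearized, ∀ v', E.IsWrite w v' → pos w < pos s →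
      ∃ c' e' v'' y', E.Chooses w c' (.write v') e' (E.opTs w) v'' y' ∧ E.opTs w ≤ ts := by
    rintro w hw v' hw' hlt
    obtain ⟨⟨c', op', e', ts', v'', y', hC'⟩, -⟩ := id hw
    obtain rfl := (isWrite_iff hC'.act).1 hw'
    rw [hpos w hw s hsL, key_lt_key, hC.opTs_eq] at hlt
    refine ⟨c', e', v'', y', by rwa [hC'.opTs_eq], ?_⟩
    obtain h | ⟨h, -⟩ := hlt
    · exact h.le
    · exact h.le
  obtain ⟨-, j, a, -, h1, h2⟩ := hC.exists_eq_of_read hqr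
  have hlegit := E.legit_rp hqr j a
  rw [h1, h2] at hlegit
  obtain ⟨h3, rfl⟩ | ⟨w, cw, ew, v', y', -, hw⟩ := hlegit
  · refine .inr ⟨rfl, fun w hw v' hw' hlt => ?_⟩
    obtain ⟨c', e', v'', y', hC', hle⟩ := before w hw v' hw' hlt
    exact absurd (h3 ▸ hle) (not_le.2 hC'.of_write.2.2.1)
  · have hwW : E.IsWrite w v := (isWrite_iff hw.act).2 rfl
    have hwL : w ∈ E.linearized :=
      ⟨⟨_, _, _, _, _, _, hw⟩, .inr ⟨⟨v, hwW⟩, s, hs, by rw [hC.opTs_eq, hw.opTs_eq]⟩⟩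
    refine .inl ⟨w, hwL, hwW, ?_, fun w' hw' v'' hw'' hlt => ?_⟩
    · rw [hpos w hwL s hsL, key_lt_key, hC.opTs_eq, hw.opTs_eq]
      refine .inr ⟨rfl, .inl ⟨?_, hread⟩⟩
      rw [isRead_iff hw.act]
      simp
    · obtain ⟨c', e', v₁, y₁, hC', hle⟩ := before w' hw' v'' hw'' hlt
      obtain heq | hlt' := hle.eq_or_lt
      · rw [heq] at hC'
        rw [hC'.eq_of_write hQ hw]
      · refine ((hpos w' hw' w hwL).2 (key_lt_key.2 (.inl ?_))).le
        rwa [hw.opTs_eq]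

theorem atomic (hqr : 0 < readQuorumSize n k r b) (hQ : E.QuorumsMeet) : E.Atomic v₀ := by
  refine ⟨fun t c y h => ?_, ?_⟩
  · obtain ⟨s, _, _, _, _, _, h, -⟩ := exists_returns_of_responds' h
    exact ⟨s, h⟩
  obtain ⟨pos, hpos⟩ := exists_pos_of_finite fun s hs => finite_key_lt (E := E) hQ (s := s) hs
  have hcomp : ∀ s, E.Complete s → s ∈ E.linearized := by
    rintro s ⟨t, y, h⟩
    obtain ⟨c, op, e, ts, v, acks, hC, -⟩ := h.exists_chooses
    exact ⟨⟨c, op, e, ts, v, y, hC⟩, .inl ⟨t, y, h⟩⟩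
  refine ⟨E.linearized, pos, ?_, hcomp, ?_, ?_, ?_⟩
  · rintro s ⟨⟨c, op, e, ts, v, y, hC⟩, -⟩
    exact ⟨c, op, hC.act⟩
  · intro s hs s' hs' h
    by_contra hne
    obtain h' | h' := lt_or_gt_of_ne (key_injective.ne hne)
    · exact absurd h ((hpos s hs s' hs').2 h').ne
    · exact absurd h ((hpos s' hs' s hs).2 h').ne'
  · rintro s hs s' hs' ⟨t, y, hret, hlt⟩
    rw [hpos s hs s' hs', key_lt_key]
    obtain ⟨⟨c, op, e, ts, v, y₁, hC⟩, -⟩ := hs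
    obtain ⟨⟨c', op', e', ts', v', y', hC'⟩, -⟩ := hs'
    obtain ⟨h1, h2⟩ := hC.le_of_returns hQ hret hlt hC'
    have hss : s < s' := by
      obtain ⟨_, _, _, h, -⟩ := hret
      omega
    rw [hC.opTs_eq, hC'.opTs_eq, isRead_iff hC.act, isRead_iff hC'.act]
    cases op' with
    | write w => exact .inl (h2 w rfl)
    | read =>
      obtain h1 | h1 := h1.eq_or_lt
      · by_cases hop : op = .read
        · exact .inr ⟨h1, .inr ⟨by simp [hop], hss⟩⟩
        · exact .inr ⟨h1, .inl ⟨hop, rfl⟩⟩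
      · exact .inl h1
  · intro s t y hret
    obtain ⟨c, op, e, ts, v, acks, hC, -⟩ := hret.exists_chooses
    rw [isRead_iff hC.act]
    refine ⟨fun v' hv' => ?_, ?_⟩
    · obtain rfl := (isWrite_iff hC.act).1 hv'
      exact hC.of_write.2.1
    · rintro rfl
      exact ⟨v, (hC.exists_eq_of_read hqr).1, readsValue hqr hQ rfl hpos hC ⟨t, y, hret⟩⟩

/-! ### Progress -/

theorem ph_succ_of_readQuorum {c t : ℕ} {op : Op V} {id : ReqId} {acks : Fin n → Option (ReadVal V)}
    (h : E.ph c t = .readQuorum op id acks) :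
    (∃ acks', E.ph c (t + 1) = .readQuorum op id acks' ∧
      (∀ j, (acks j).isSome → (acks' j).isSome) ∧
      (∀ src x j, E.act t = .deliver src (.cli c) (.readAck id x j) → (acks' j).isSome) ∧
      (E.act t = .tick (.cli c) →
        (Finset.univ.filter fun j => (acks j).isSome).card < readQuorumSize n k r b)) ∨
    E.act t = .tick (.cli c) ∧ ∃ id ts v y, E.ph c (t + 1) = .writeQuorum id ts v ∅ y := by
  obtain ⟨o, hm, -, -⟩ := E.exists_clientMove c t
  unfold ph at h ⊢
  generalize E.cl c t = σ at hm h
  generalize E.cl c (t + 1) = σ' at hm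
  cases hm with
  | stay _ hw hr hra hwa hi =>
    exact .inl ⟨acks, h, fun _ h => h, fun src x j he => hra _ _ _ _ _ _ he h,
      fun he => hr _ _ _ he h⟩
  | readAck src m op id x j acks he hj =>
    simp only [Phase.readQuorum.injEq] at h
    obtain ⟨rfl, rfl, rfl⟩ := h
    refine .inl ⟨_, rfl, fun j' hj' => ?_, fun src' x' j' he' => ?_, by simp [he]⟩
    · by_cases hjj : j' = j
      · simp [hjj]
      · rwa [Function.update_of_ne hjj]
    · rw [he] at he'
      simp only [Event.deliver.injEq, RegMsg.readAck.injEq] at he'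
      simp [← he'.2.2.2.2]
  | switch m op' id' acks' ts v y he hq hc => exact .inr ⟨he, _, _, _, _, rfl⟩
  | _ => simp at h

theorem ph_succ_of_writeQuorum {c t : ℕ} {id : ReqId} {ts : Timestamp} {v : V}
    {acks : Finset (Fin n)} {y : Resp V} (h : E.ph c t = .writeQuorum id ts v acks y) :
    (∃ acks', E.ph c (t + 1) = .writeQuorum id ts v acks' y ∧ acks ⊆ acks' ∧
      (∀ src j, E.act t = .deliver src (.cli c) (.writeAck id j) → j ∈ acks')) ∨
    E.Responds t c y := by
  obtain ⟨o, hm, ho, -⟩ := E.exists_clientMove c t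
  rw [ho]
  unfold ph at h ⊢
  generalize E.cl c t = σ at hm h
  generalize E.cl c (t + 1) = σ' at hm
  cases hm with
  | stay _ hw hr hra hwa hi =>
    exact .inl ⟨acks, h, subset_rfl, fun src j he => absurd h (hwa _ _ _ _ _ _ _ he)⟩
  | writeAck src m id t v acks y j he =>
    simp only [Phase.writeQuorum.injEq] at h
    obtain ⟨rfl, rfl, rfl, rfl, rfl⟩ := h
    refine .inl ⟨_, rfl, Finset.subset_insert _ _, fun src' j' he' => ?_⟩
    rw [he] at he'
    simp only [Event.deliver.injEq, RegMsg.writeAck.injEq] at he'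
    simp [← he'.2.2.2]
  | finish m id t v acks y' he hq =>
    simp only [Phase.writeQuorum.injEq] at h
    exact .inr (by rw [h.2.2.2.2])
  | _ => simp at h

/-- A client that is in `read_quorum` records all answers that it receives until it leaves. -/
theorem ph_of_readQuorum {c a t : ℕ} {op : Op V} {id : ReqId} {acks : Fin n → Option (ReadVal V)}
    (h : E.ph c a = .readQuorum op id acks) (hat : a ≤ t) :
    (∃ acks', E.ph c t = .readQuorum op id acks' ∧ ∀ t' src x j, a ≤ t' → t' < t →
      E.act t' = .deliver src (.cli c) (.readAck id x j) → (acks' j).isSome) ∨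
    ∃ e, a ≤ e ∧ e < t ∧ E.act e = .tick (.cli c) ∧
      ∃ id ts v y, E.ph c (e + 1) = .writeQuorum id ts v ∅ y := by
  induction t, hat using Nat.le_induction with
  | base => exact .inl ⟨acks, h, fun _ _ _ _ h1 h2 => by omega⟩
  | succ t hat ih =>
    obtain ⟨acks', h1, h2⟩ | ⟨e, h1, h2, h3⟩ := ih
    · obtain ⟨acks'', h3, h4, h5, -⟩ | h3 := ph_succ_of_readQuorum h1
      · refine .inl ⟨acks'', h3, fun t' src x j h6 h7 h8 => ?_⟩
        obtain rfl | h7 := Nat.le_iff_lt_or_eq.1 (Nat.lt_succ_iff.1 h7) |>.symm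
        · exact h5 _ _ _ h8
        · exact h4 _ (h2 _ _ _ _ h6 h7 h8)
      · exact .inr ⟨t, hat, by omega, h3⟩
    · exact .inr ⟨e, h1, by omega, h3⟩

/-- A client that is in `write_quorum` records all acknowledgements that it receives until it
returns. -/
theorem ph_of_writeQuorum {c a t : ℕ} {id : ReqId} {ts : Timestamp} {v : V}
    {acks : Finset (Fin n)} {y : Resp V} (h : E.ph c a = .writeQuorum id ts v acks y) (hat : a ≤ t)
    (hno : ∀ t', a ≤ t' → t' < t → ∀ y, ¬ E.Responds t' c y) :
    ∃ acks', E.ph c t = .writeQuorum id ts v acks' y ∧ ∀ t' src j, a ≤ t' → t' < t →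
      E.act t' = .deliver src (.cli c) (.writeAck id j) → j ∈ acks' := by
  induction t, hat using Nat.le_induction with
  | base => exact ⟨acks, h, fun _ _ _ h1 h2 => by omega⟩
  | succ t hat ih =>
    obtain ⟨acks', h1, h2⟩ := ih fun t' h3 h4 => hno t' h3 (by omega)
    obtain ⟨acks'', h3, h4, h5⟩ | h3 := ph_succ_of_writeQuorum h1
    · refine ⟨acks'', h3, fun t' src j h6 h7 h8 => ?_⟩
      obtain rfl | h7 := Nat.le_iff_lt_or_eq.1 (Nat.lt_succ_iff.1 h7) |>.symm
      · exact h5 _ _ h8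
      · exact h4 (h2 _ _ _ h6 h7 h8)
    · exact absurd h3 (hno t hat (by omega) y)

variable (E) in
/-- `D i` is the set of times within `i` message delays of some starting point.  The client `c` and the
replicas in `R` and `W` communicate timely during the four delays, and `c` takes a local step after
each receipt unless it is idle; the replicas in `R` are never stale.  Both bounded delays and fairness
are instances. -/
structure Timely (c : ℕ) (R W : Finset (Fin n)) (D : ℕ → Set ℕ) : Prop where
  mono : Monotone D
  conn : ∀ i, (D i).OrdConnected
  request : ∀ i < 4, ∀ t ∈ D i, ∀ j, j ∈ R ∨ j ∈ W → ∀ m : RegMsg n V,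
    E.Sends t (.cli c) (.rep j) m → ∃ t' > t, t' ∈ D (i + 1) ∧ E.act t' = .deliver (.cli c) (.rep j) m
  reply : ∀ i < 4, ∀ t ∈ D i, ∀ j, j ∈ R ∨ j ∈ W → ∀ m : RegMsg n V,
    E.Sends t (.rep j) (.cli c) m → ∃ t' > t, t' ∈ D (i + 1) ∧ E.act t' = .deliver (.rep j) (.cli c) m
  tick : ∀ i ≤ 4, ∀ t ∈ D i, (∃ src m, E.act t = .deliver src (.cli c) m) → E.ph c (t + 1) ≠ .idle →
    ∃ t' > t, t' ∈ D i ∧ E.act t' = .tick (.cli c)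
  stale : ∀ j ∈ R, ∀ t, (E.rp j t).stale = false
  card_le_R : readQuorumSize n k r b ≤ R.card
  card_le_W : n - k ≤ W.card

/-- From the start of `write_quorum`, or a retransmission there, two message delays suffice. -/
theorem Timely.exists_responds_of_writeQuorum (hk : k < n) {c : ℕ} {R W : Finset (Fin n)}
    {D : ℕ → Set ℕ} (h : E.Timely c R W D) {e : ℕ} (he : e ∈ D 2) (hact : E.act e = .tick (.cli c))
    {id : ReqId} {ts : Timestamp} {v : V} {acks : Finset (Fin n)} {y : Resp V}
    (hph : E.ph c (e + 1) = .writeQuorum id ts v acks y) :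
    ∃ t ∈ D 4, e ≤ t ∧ ∃ y, E.Responds t c y := by
  by_contra! hno
  -- Acknowledgements are counted only as long as the client has not returned.
  have hno' : ∀ t ∈ D 4, ∀ t', e ≤ t' → t' ≤ t → ∀ y, ¬ E.Responds t' c y :=
    fun t ht t' h1 h2 => hno t' ((h.conn 4).out (h.mono (by norm_num) he) ht ⟨h1, h2⟩) h1
  have hack : ∀ j ∈ W, ∃ t ∈ D 4, e < t ∧ E.act t = .deliver (.rep j) (.cli c) (.writeAck id j) := by
    intro j hj
    obtain ⟨t2, h1, h2, h3⟩ := h.request 2 (by norm_num) e he j (.inr hj) (.write id ts v)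
      (E.sends_cli_iff.2 ⟨hact, ⟨j, rfl⟩, .inr ⟨_, _, _, _, _, hph, rfl⟩⟩)
    obtain ⟨t3, h4, h5, h6⟩ := h.reply 3 (by norm_num) t2 h2 j (.inr hj) (.writeAck id j)
      (E.sends_rep_iff.2 (.inr ⟨_, _, _, h3, rfl⟩))
    exact ⟨t3, h5, by omega, h6⟩
  choose! f hf1 hf2 hf3 using hack
  have hne : W.Nonempty := Finset.card_pos.1 (lt_of_lt_of_le (by omega) h.card_le_W)
  obtain ⟨j, hj, hmax⟩ := W.exists_max_image f hne
  obtain ⟨t4, h1, h2, h3⟩ := h.tick 4 le_rfl (f j) (hf1 j hj) ⟨_, _, hf3 j hj⟩ <| by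
    refine ph_ne_idle_of_forall_not_responds (s := e + 1) (by simp [hph])
      (by have := hf2 j hj; omega) fun t' h1 h2 => hno' _ (hf1 j hj) t' (by omega) (by omega)
  have hlt := hf2 j hj
  obtain ⟨acks', h4, h5⟩ := ph_of_writeQuorum (t := t4) hph (by omega) fun t' h4 h5 =>
    hno' t4 h2 t' (by omega) (by omega)
  refine hno t4 h2 (by omega) y (responds_iff.2 ⟨h3, _, _, _, _, h4, h.card_le_W.trans ?_⟩)
  refine Finset.card_le_card fun i hi => ?_
  have := hmax i hi
  exact h5 (f i) _ i (hf2 i hi) (by omega) (hf3 i hi)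

/-- From any local step during an operation, four message delays suffice. -/
theorem Timely.exists_responds (hk : k < n) (hqr : 0 < readQuorumSize n k r b) {c : ℕ}
    {R W : Finset (Fin n)} {D : ℕ → Set ℕ} (h : E.Timely c R W D) {t : ℕ} (ht : t ∈ D 0)
    (hact : E.act t = .tick (.cli c)) (hph : E.ph c t ≠ .idle) :
    ∃ t' ∈ D 4, t ≤ t' ∧ ∃ y, E.Responds t' c y := by
  have write : ∀ e ∈ D 2, t ≤ e → E.act e = .tick (.cli c) → ∀ {id ts v acks y},
      E.ph c (e + 1) = .writeQuorum id ts v acks y → ∃ t' ∈ D 4, t ≤ t' ∧ ∃ y, E.Responds t' c y := by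
    intro e he hte hact id ts v acks y hph
    obtain ⟨t', h1, h2, h3⟩ := h.exists_responds_of_writeQuorum hk he hact hph
    exact ⟨t', h1, hte.trans h2, h3⟩
  have ht2 : t ∈ D 2 := h.mono (by norm_num) ht
  cases hph' : E.ph c t with
  | idle => exact absurd hph' hph
  | writeQuorum id ts v acks y =>
    obtain ⟨acks', h1, -⟩ | h1 := ph_succ_of_writeQuorum hph'
    · exact write t ht2 le_rfl hact h1
    · exact ⟨t, h.mono (by norm_num) ht, le_rfl, y, h1⟩
  | readQuorum op id acks =>
    obtain ⟨acks', h1, -⟩ | ⟨-, _, _, _, _, h1⟩ := ph_succ_of_readQuorum hph'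
    swap
    · exact write t ht2 le_rfl hact h1
    have hack : ∀ j ∈ R, ∃ t' ∈ D 2, t < t' ∧ ∃ x,
        E.act t' = .deliver (.rep j) (.cli c) (.readAck id x j) := by
      intro j hj
      obtain ⟨t2, h2, h3, h4⟩ := h.request 0 (by norm_num) t ht j (.inl hj)
        (.read id (requestOf op)) (E.sends_cli_iff.2 ⟨hact, ⟨j, rfl⟩, .inl ⟨_, _, _, h1, rfl⟩⟩)
      obtain ⟨t3, h5, h6, h7⟩ := h.reply 1 (by norm_num) t2 h3 j (.inl hj)
        (.readAck id ((requestOf op).answer (E.rp j t2)) j)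
        (E.sends_rep_iff.2 (.inl ⟨_, _, h4, h.stale j hj t2, rfl⟩))
      exact ⟨t3, h6, by omega, _, h7⟩
    choose! f hf1 hf2 x hf3 using hack
    -- When the last of these answers arrives, the client has recorded all of them or has moved on.
    obtain ⟨j, hj, hmax⟩ := R.exists_max_image f (Finset.card_pos.1 (hqr.trans_le h.card_le_R))
    have hlt := hf2 j hj
    obtain ⟨acks₁, h2, -⟩ | ⟨e, h2, h3, h4, _, _, _, _, h5⟩ :=
      ph_of_readQuorum (t := f j + 1) h1 (by omega)
    swap
    · exact write e ((h.conn 2).out ht2 (hf1 j hj) ⟨by omega, by omega⟩) (by omega) h4 h5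
    obtain ⟨t4, h3, h4, h5⟩ := h.tick 2 (by norm_num) (f j) (hf1 j hj) ⟨_, _, hf3 j hj⟩ (by simp [h2])
    obtain ⟨acks₂, h6, h7⟩ | ⟨e, h6, h7, h8, _, _, _, _, h9⟩ :=
      ph_of_readQuorum (t := t4) h1 (by omega)
    swap
    · exact write e ((h.conn 2).out ht2 h4 ⟨by omega, by omega⟩) (by omega) h8 h9
    obtain ⟨_, -, -, -, h8⟩ | ⟨-, _, _, _, _, h8⟩ := ph_succ_of_readQuorum h6
    swap
    · exact write t4 h4 (by omega) h5 h8
    refine absurd (h.card_le_R.trans (Finset.card_le_card fun i hi => ?_)) (not_le.2 (h8 h5))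
    have := hmax i hi
    exact Finset.mem_filter.2 ⟨Finset.mem_univ _, h7 (f i) _ _ i (hf2 i hi) (by omega) (hf3 i hi)⟩

theorem tickEnabled (hn : 0 < n) {c t : ℕ} (h : E.ph c t ≠ .idle) :
    TickEnabled (algorithmKnown v₀ k r b S) (E.cfg t) (.cli c) := by
  change clientStep v₀ (n - k) (readQuorumSize n k r b) c .tick (E.cl c t) ≠ ⟨E.cl c t, [], none⟩
  have hb : ∀ m : RegMsg n V, broadcast m ≠ [] := by
    intro m h
    simp only [broadcast, List.map_eq_nil_iff, List.finRange_eq_nil_iff] at h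
    omega
  unfold ph at h
  generalize E.cl c t = σ at h
  obtain ⟨m, p⟩ := σ
  cases p with
  | idle => exact absurd rfl h
  | readQuorum op id acks =>
    simp only [clientStep]
    split_ifs <;> simp [hb]
  | writeQuorum id ts v acks y =>
    simp only [clientStep]
    split_ifs <;> simp [hb]

/-! ### Counting replicas -/

theorem up_of_not_crashes {A : Implementation n V} (E : Execution A) {p : Proc n}
    (h : ¬ E.Crashes p) (t : ℕ) : E.Up p t := by
  induction t with
  | zero => simp [Up, E.init, Config.initial]
  | succ t ih =>
    unfold Up at ih ⊢
    have hp : E.ev t ≠ .crash p := fun he => h ⟨t, he⟩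
    rw [E.next t]
    generalize E.ev t = e at hp
    rcases e with _ | ⟨c', op⟩ | ⟨src, i | c', m⟩ | (i | c') | q | i | ⟨i, s⟩ <;>
      simp only [step, stepClient, stepReplica, stepRestart, Function.update_apply] <;>
      try exact ih
    all_goals
      split_ifs with hq
      · first
        | rfl
        | exact absurd (by rw [hq]) hp
      · exact ih

theorem card_le_card_filter_compl {p : Fin n → Prop} [DecidablePred p] {m : ℕ}
    (h : {i | p i}.ncard ≤ m) : n - m ≤ (Finset.univ.filter fun i => ¬ p i).card := by
  have h1 : {i | p i}.ncard = (Finset.univ.filter p).card := by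
    rw [← Set.ncard_coe_finset]
    simp
  have h2 := Finset.card_filter_add_card_filter_not (s := (Finset.univ : Finset (Fin n))) p
  simp only [Finset.card_univ, Fintype.card_fin] at h2
  omega

/-- Among the replicas that are up, or have not crashed, there are enough that answer `READ`. -/
theorem exists_readers (hn : 2 * k + b + 1 ≤ n ∨ P n k r b)
    (hf : {i | E.FaultyReplica i}.ncard ≤ k) (hb : {i | E.BenignReplica i}.ncard ≤ b)
    {W : Finset (Fin n)} (hW : n - k ≤ W.card) :
    ∃ R : Finset (Fin n), readQuorumSize n k r b ≤ R.card ∧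
      (∀ j ∈ R, ∀ t, (E.rp j t).stale = false) ∧ ∀ j ∈ R, j ∈ W ∨ ∀ t, E.Up (.rep j) t := by
  classical
  by_cases hP : P n k r b
  · refine ⟨W, by rwa [readQuorumSize, if_pos hP], fun j _ t => E.stale_eq_false_of_P hP j t,
      fun j hj => .inl hj⟩
  · -- A replica that crashes is faulty or benign.
    have h1 : {i | E.Crashes (.rep i)}.ncard ≤ k + b := by
      refine (Set.ncard_le_ncard (t := {i | E.FaultyReplica i} ∪ {i | E.BenignReplica i}) ?_).trans
        ((Set.ncard_union_le _ _).trans (Nat.add_le_add hf hb))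
      intro i hi
      by_cases hc : E.CorrectReplica i
      · exact .inr ⟨hc, hi⟩
      · exact .inl hc
    have h2 := card_le_card_filter_compl h1
    have hup : ∀ j ∈ Finset.univ.filter fun i => ¬ E.Crashes (.rep i), ∀ t, E.Up (.rep j) t :=
      fun j hj t => E.up_of_not_crashes (Finset.mem_filter.1 hj).2 t
    refine ⟨_, ?_, fun j hj => E.stale_eq_false_of_up (hup j hj), fun j hj => .inr (hup j hj)⟩
    rw [readQuorumSize, if_neg hP]
    obtain hn | hn := hn
    · exact le_trans (by omega) h2
    · exact absurd hn hP

end Execution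

/-- The first `m` elements of a finite set with at least `m` elements are at least `m` many. -/
theorem le_card_filter_card_lt {α : Type*} [LinearOrder α] {m : ℕ} (s : Finset α) (h : m ≤ s.card) :
    m ≤ (s.filter fun i => (s.filter (· < i)).card < m).card := by
  induction s using Finset.induction_on_max with
  | empty => simpa using h
  | insert a s ha ih =>
    have hnot : a ∉ s := fun h' => lt_irrefl _ (ha a h')
    obtain hm | hm := h.eq_or_lt
    · rw [Finset.filter_true_of_mem, ← hm]
      intro i hi
      rw [hm]
      exact Finset.card_lt_card (Finset.filter_ssubset.2 ⟨i, hi, lt_irrefl _⟩)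
    · rw [Finset.card_insert_of_notMem hnot] at hm
      refine (ih (by omega)).trans (Finset.card_le_card fun i hi => ?_)
      simp only [Finset.mem_filter] at hi ⊢
      refine ⟨Finset.mem_insert_of_mem hi.1, ?_⟩
      rw [Finset.filter_insert, if_neg (ha i hi.1).not_gt]
      exact hi.2

namespace Execution

variable {E : Execution (algorithmKnown v₀ k r b S)}

/-- If `P` holds, fewer than `2 * k + r + 1` replicas are outside one of the quorums or roll back; if `P`
fails, the sizes of the quorums add up to more than `n`. -/
theorem quorumsMeet (hn : 2 * k + b + 1 ≤ n ∨ P n k r b ∧ 2 * k + r + 1 ≤ S.card)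
    (hr : {i | E.RollsBack i}.ncard ≤ r) : E.QuorumsMeet := by
  classical
  intro Qw Qr hw hq
  have hcw : Qwᶜ.card = n - Qw.card := by rw [Finset.card_compl, Fintype.card_fin]
  have hcr : Qrᶜ.card = n - Qr.card := by rw [Finset.card_compl, Fintype.card_fin]
  have hr' : {i | E.RollsBack i}.ncard = (Finset.univ.filter E.RollsBack).card := by
    rw [← Set.ncard_coe_finset]
    simp
  unfold readQuorumSize at hq
  by_contra! hno
  by_cases hP : P n k r b
  · rw [if_pos hP] at hq
    obtain hn | ⟨-, hS⟩ := hn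
    · exact absurd hP.2 (by omega)
    have hM := le_card_filter_card_lt S hS
    have hsub : (S.filter fun i => (S.filter (· < i)).card < 2 * k + r + 1) ⊆
        Qwᶜ ∪ Qrᶜ ∪ Finset.univ.filter E.RollsBack := by
      intro j hj
      rw [Finset.mem_filter] at hj
      simp only [Finset.mem_union, Finset.mem_compl, Finset.mem_filter, Finset.mem_univ, true_and]
      by_contra! hcon
      obtain ⟨-, h⟩ := hno j hcon.1.1 hcon.1.2
      exact hcon.2 (h ⟨hP, hj.1, hj.2⟩)
    have h1 := Finset.card_le_card hsub
    have h2 := Finset.card_union_le (Qwᶜ ∪ Qrᶜ) (Finset.univ.filter E.RollsBack)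
    have h3 := Finset.card_union_le Qwᶜ Qrᶜ
    omega
  · rw [if_neg hP] at hq
    have hsub : Qw ⊆ Qrᶜ := by
      intro j hj
      rw [Finset.mem_compl]
      exact fun hj' => hP (hno j hj hj').1
    have h1 := Finset.card_le_card hsub
    omega

/-! ### Wait freedom -/

theorem waitFree (hn : 2 * k + b + 1 ≤ n ∨ P n k r b)
    (hf : {i | E.FaultyReplica i}.ncard ≤ k) (hb : {i | E.BenignReplica i}.ncard ≤ b)
    (hfair : E.Fair) : E.WaitFree := by
  classical
  intro s c op hs hc
  by_contra hno
  have hk : k < n := by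
    obtain hn | hn := hn
    · omega
    · have := hn.1
      omega
  have hqr : 0 < readQuorumSize n k r b := by
    unfold readQuorumSize
    split_ifs <;> omega
  have hno' : ∀ t y, s ≤ t → ¬ E.Responds t c y := by
    intro t y h1 h2
    obtain ⟨t', -, y', h3⟩ := exists_returns_of_responds hs h1 h2
    exact hno ⟨t', y', h3⟩
  have hph : ∀ t, s < t → E.ph c t ≠ .idle :=
    fun t ht => ph_ne_idle_of_act_invoke hs ht fun t' h1 _ y => hno' t' y h1
  have hupc := E.up_of_not_crashes hc
  have htick : ∀ t, s < t → ∃ t' ≥ t, E.act t' = .tick (.cli c) := fun t ht =>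
    hfair.2 (.cli c) t fun t' ht' => ⟨hupc t', tickEnabled (by omega) (hph t' (by omega))⟩
  obtain ⟨R, hR1, hR2, hR3⟩ := exists_readers hn hf hb (card_le_card_filter_compl hf)
  have hW : ∃ t₀, ∀ t ≥ t₀, ∀ j ∈ Finset.univ.filter fun i => ¬ E.FaultyReplica i,
      E.Up (.rep j) t := by
    rw [← Filter.eventually_atTop, Filter.eventually_all_finset]
    intro j hj
    rw [Filter.eventually_atTop]
    exact (not_not.1 (Finset.mem_filter.1 hj).2).1
  obtain ⟨t₀, ht₀⟩ := hW
  have hup : ∀ t ≥ t₀, ∀ j, j ∈ R ∨ j ∈ Finset.univ.filter (fun i => ¬ E.FaultyReplica i) →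
      E.Up (.rep j) t := by
    rintro t ht j (hj | hj)
    · obtain hj | hj := hR3 j hj
      · exact ht₀ t ht j hj
      · exact hj t
    · exact ht₀ t ht j hj
  -- Fairness sets no deadline, so "within `i` delays" means any time after `t₀`.
  have hT : E.Timely c R (Finset.univ.filter fun i => ¬ E.FaultyReplica i)
      (fun _ => Set.Ici (max t₀ (s + 1))) :=
    { mono := fun _ _ _ => le_rfl
      conn := fun _ => Set.ordConnected_Ici
      request := fun i _ t ht j hj m hm => by
        have ht' : max t₀ (s + 1) ≤ t := ht
        obtain ⟨t', h1, h2⟩ := hfair.1 (.cli c) (.rep j) t₀ (fun t ht => ⟨hupc t, hup t ht j hj⟩) t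
          (by omega) m hm
        exact ⟨t', h1, ht'.trans h1.le, h2⟩
      reply := fun i _ t ht j hj m hm => by
        have ht' : max t₀ (s + 1) ≤ t := ht
        obtain ⟨t', h1, h2⟩ := hfair.1 (.rep j) (.cli c) t₀ (fun t ht => ⟨hup t ht j hj, hupc t⟩) t
          (by omega) m hm
        exact ⟨t', h1, ht'.trans h1.le, h2⟩
      tick := fun i _ t ht _ _ => by
        have ht' : max t₀ (s + 1) ≤ t := ht
        obtain ⟨t', h1, h2⟩ := htick (t + 1) (by omega)
        exact ⟨t', h1, Set.mem_Ici.2 (by omega), h2⟩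
      stale := hR2
      card_le_R := hR1
      card_le_W := card_le_card_filter_compl hf }
  obtain ⟨t, h1, h2⟩ := htick (max t₀ (s + 1)) (by omega)
  obtain ⟨t', -, h3, y, h4⟩ := hT.exists_responds hk hqr h1 h2 (hph t (by omega))
  exact hno' t' y (by omega) h4

/-! ### Time complexity -/

/-- The client takes a local step at once after the event at time `u`, whatever phase it is in, and this
starts the four delays. -/
theorem exists_returns_of_timelyFrom (hn : 2 * k + b + 1 ≤ n ∨ P n k r b)
    (hf : {i | E.FaultyReplica i}.ncard ≤ k) (hb : {i | E.BenignReplica i}.ncard ≤ b)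
    {T : ℕ → ℝ} (hT : Monotone T) {s c u : ℕ} {op : Op V} (hs : E.act s = .invoke c op) (hsu : s ≤ u)
    (h : E.TimelyFrom T k c u 4) : ∃ t y, E.Returns s t y ∧ T t ≤ T u + 4 := by
  classical
  have hk : k < n := by
    obtain hn | hn := hn
    · omega
    · have := hn.1
      omega
  have hqr : 0 < readQuorumSize n k r b := by
    unfold readQuorumSize
    split_ifs <;> omega
  obtain ⟨hupc, hcard, hdel, hprompt, hpu⟩ := h
  by_contra! hno
  have hno' : ∀ t, s ≤ t → T t ≤ T u + 4 → ∀ y, ¬ E.Responds t c y := by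
    intro t h1 h2 y h3
    obtain ⟨t', h4, y', h5⟩ := exists_returns_of_responds hs h1 h3
    exact absurd ((hT h4).trans h2) (not_le.2 (hno t' y' h5))
  -- The state at time `t` is the one after the event at time `t - 1`, which has to be in time.
  have hph : ∀ t, s < t → T (t - 1) ≤ T u + 4 → E.ph c t ≠ .idle := by
    intro t h1 h2
    refine ph_ne_idle_of_act_invoke hs h1 fun t' h3 h4 => hno' t' h3 ?_
    exact (hT (show t' ≤ t - 1 by omega)).trans h2
  obtain ⟨t, htu, hact, htT⟩ := hpu (tickEnabled (by omega) (hph (u + 1) (by omega) (by simp)))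
  have hW : n - k ≤ (Finset.univ.filter fun i : Fin n => E.UpThroughout T u 4 (.rep i)).card := by
    rw [← Set.ncard_coe_finset]
    simp only [Finset.coe_filter, Finset.mem_univ, true_and]
    omega
  obtain ⟨R, hR1, hR2, hR3⟩ := exists_readers hn hf hb hW
  have hup : ∀ j, j ∈ R ∨ j ∈ (Finset.univ.filter fun i : Fin n => E.UpThroughout T u 4 (.rep i)) →
      E.UpThroughout T u 4 (.rep j) := by
    have hmem : ∀ j ∈ (Finset.univ.filter fun i : Fin n => E.UpThroughout T u 4 (.rep i)),
      E.UpThroughout T u 4 (.rep j) := fun j hj => (Finset.mem_filter.1 hj).2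
    rintro j (hj | hj)
    · obtain hj | hj := hR3 j hj
      · exact hmem j hj
      · exact fun t _ _ => hj t
    · exact hmem j hj
  have hle : ∀ i : ℕ, i ≤ 4 → T u + i ≤ T u + 4 := fun i hi => by
    have : (i : ℝ) ≤ 4 := by exact_mod_cast hi
    linarith
  have hTimely : E.Timely c R (Finset.univ.filter fun i : Fin n => E.UpThroughout T u 4 (.rep i))
      (fun i => {t | u ≤ t ∧ T t ≤ T u + i}) :=
    { mono := fun i i' hi t ht => ⟨ht.1, ht.2.trans (by gcongr)⟩
      conn := fun i => ⟨fun t ht t' ht' t'' ht'' =>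
        ⟨ht.1.trans ht''.1, (hT ht''.2).trans ht'.2⟩⟩
      request := fun i hi t ht j hj m hm => by
        obtain ⟨t', h1, h2, h3⟩ := hdel _ _ hupc (hup j hj) t ht.1 (ht.2.trans (hle i hi.le)) m hm
        refine ⟨t', h1, ⟨ht.1.trans h1.le, ?_⟩, h2⟩
        have := ht.2
        push_cast
        linarith
      reply := fun i hi t ht j hj m hm => by
        obtain ⟨t', h1, h2, h3⟩ := hdel _ _ (hup j hj) hupc t ht.1 (ht.2.trans (hle i hi.le)) m hm
        refine ⟨t', h1, ⟨ht.1.trans h1.le, ?_⟩, h2⟩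
        have := ht.2
        push_cast
        linarith
      tick := fun i hi t ht hd hidle => by
        obtain ⟨t', h1, h2, h3⟩ := hprompt _ hupc t ht.1 (ht.2.trans (hle i hi)) (.inl hd)
          (tickEnabled (by omega) hidle)
        exact ⟨t', h1, ⟨ht.1.trans h1.le, h3.trans_le ht.2⟩, h2⟩
      stale := hR2
      card_le_R := hR1
      card_le_W := hW }
  have htT' : T (t - 1) ≤ T u + 4 := by
    have := hT (show t - 1 ≤ t by omega)
    linarith
  obtain ⟨t', h1, h2, y, h3⟩ := hTimely.exists_responds hk hqr (t := t)
    ⟨htu.le, by simp [htT]⟩ hact (hph t (by omega) htT')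
  refine hno' t' (by omega) ?_ y h3
  exact_mod_cast h1.2

/-- An operation waits for two round trips. -/
theorem le_of_slowChannels (hk : k < n) (hqr : 0 < readQuorumSize n k r b) {T : ℕ → ℝ}
    (hT : Monotone T) (hslow : E.SlowChannels T) {s t : ℕ} {y : Resp V} (h : E.Returns s t y) :
    T s + 4 ≤ T t := by
  obtain ⟨c, op, e, ts, v, acks, hC, hW, hq⟩ := h.exists_chooses
  have hslow' : ∀ t src dst, ∀ m : RegMsg n V, E.act t = .deliver src dst m →
      ∃ s < t, E.Sends s src dst m ∧ T s + 1 ≤ T t := hslow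
  -- `write_quorum`, which starts at time `e`, takes one round trip, and so does `read_quorum`.
  have h1 : T e + 2 ≤ T t := by
    obtain ⟨j, hj⟩ := Finset.card_pos.1 (lt_of_lt_of_le (by omega) hq)
    obtain ⟨src, t3, -, h3, h3'⟩ := hW.ack j hj
    obtain ⟨t2, -, h2', h2⟩ := hslow' _ _ _ _ h3'
    obtain ⟨ts', v', h4⟩ := act_of_sends_writeAck h2'
    obtain ⟨t1, -, h1', h1⟩ := hslow' _ _ _ _ h4
    have := hT (le_of_sends_write hC h1').1
    have := hT h3.le
    linarith
  obtain ⟨acks', hR, -, hq', -⟩ := hC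
  obtain ⟨j, hj⟩ := Finset.card_pos.1 (hqr.trans_le hq')
  obtain ⟨x, hx⟩ := Option.isSome_iff_exists.1 (Finset.mem_filter.1 hj).2
  obtain ⟨src, t3, -, h3, h3'⟩ := hR.ack j x hx
  obtain ⟨t2, -, h2', h2⟩ := hslow' _ _ _ _ h3'
  obtain ⟨req, h4, -, -⟩ := act_of_sends_readAck h2'
  obtain ⟨t1, -, h1', h1⟩ := hslow' _ _ _ _ h4
  have := hT (le_of_sends_read hR.act h1').1
  have := hT h3.le
  linarith

end Execution

end CRR

theorem mainTheorem3 {V : Type*} (v₀ : V) (n k s : ℕ) (r b : Option ℕ)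
    (hr : ∀ r' ∈ r, r' ≤ k) (hb : ∀ b' ∈ b, b' ≤ n)
    (S : Finset (Fin n)) (hS : S.card = s)
    (h : 2 * k + b.getD n + 1 ≤ n ∨
      (2 * k + r.getD k + 1 ≤ n ∧ n < 2 * k + b.getD n + 1 ∧ 2 * k + r.getD k + 1 ≤ s)) :
    (∀ i, (CRR.algorithm v₀ k r b S).UsesStorage i → i ∈ S) ∧
    CRR.IsTolerantAtomicWaitFree (CRR.algorithm v₀ k r b S) v₀ k r b ∧
    CRR.HasTimeComplexity (CRR.algorithm v₀ k r b S) k r b 4 := by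
  unfold CRR.algorithm
  have hn : 2 * k + b.getD n + 1 ≤ n ∨
      CRR.P n k (r.getD k) (b.getD n) ∧ 2 * k + r.getD k + 1 ≤ S.card := by
    rw [hS]
    exact h.imp_right fun h => ⟨⟨h.1, h.2.1⟩, h.2.2⟩
  have hn' := hn.imp_right And.left
  have hk : k < n := by omega
  have hqr : 0 < CRR.readQuorumSize n k (r.getD k) (b.getD n) := by
    unfold CRR.readQuorumSize
    split_ifs <;> omega
  have hroll : ∀ E : CRR.Execution (CRR.algorithmKnown v₀ k (r.getD k) (b.getD n) S),
      E.FailuresWithin k r b → {i | E.RollsBack i}.ncard ≤ r.getD k := by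
    intro E hE
    cases r with
    | none =>
      have hsub : {i | E.RollsBack i} ⊆ {i | E.FaultyReplica i} := fun i hi hc => hc.2 hi
      exact (Set.ncard_le_ncard hsub).trans hE.1
    | some r => exact hE.2.1 r rfl
  have hben : ∀ E : CRR.Execution (CRR.algorithmKnown v₀ k (r.getD k) (b.getD n) S),
      E.FailuresWithin k r b → {i | E.BenignReplica i}.ncard ≤ b.getD n := by
    intro E hE
    cases b with
    | none => simpa using Set.ncard_le_card {i | E.BenignReplica i}
    | some b => exact hE.2.2 b rfl
  refine ⟨?_, fun E hE => ⟨?_, ?_⟩, fun E hE T hT => ⟨?_, ?_⟩⟩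
  · rintro i ⟨σ, σ', hne⟩
    by_contra hi
    refine hne ?_
    change (if CRR.Persists k (r.getD k) (b.getD n) S i then some σ else none) =
      if CRR.Persists k (r.getD k) (b.getD n) S i then some σ' else none
    rw [if_neg fun h => hi h.2.1, if_neg fun h => hi h.2.1]
  · exact CRR.Execution.atomic hqr (CRR.Execution.quorumsMeet hn (hroll E hE))
  · exact CRR.Execution.waitFree hn' hE.1 (hben E hE)
  · intro s' c op u hs hsu hu
    exact CRR.Execution.exists_returns_of_timelyFrom hn' hE.1 (hben E hE) hT hs hsu (by simpa using hu)
  · intro hslow s' t y hret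
    simpa using CRR.Execution.le_of_slowChannels hk hqr hT hslow hret
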